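/- **Notation.** For $f:[0,1]\to\mathbb R$ and $I=[a,b]\subseteq[0,1]$, $a<b$, let $\mathrm{Sec}[f,I](x)=\frac{b-x}{b-a}f(a)+\frac{x-a}{b-a}f(b)$, and let $\Delta(f,x,t)=\frac{f(x-t)+f(x+t)}2-f(x)$. For $\epsilon>0$ let $$\omega(f,x,\epsilon)=\min\{t\in[0,\min\{x,1-x\}]:\Delta(f,x,t)\ge\epsilon\},$$ $$t_{\rm left}(f,\epsilon)=\inf\{t\in[0,\tfrac12]:\Delta(f,t,t)\ge\epsilon\},\qquad t_{\rm right}(f,\epsilon)=\inf\{t\in[0,\tfrac12]:\Delta(f,1-t,t)\ge\epsilon\},$$ (an empty infimum being $\tfrac12$), let $\omega_{\max}(f,\epsilon),\omega_{\min}(f,\epsilon)$ be the maximum and minimum of $\omega(f,\cdot,\epsilon)$ on $[t_{\rm left},1-t_{\rm right}]$, and $$\Lambda_{\rm avg}(f,\epsilon)=1+\int_{t_{\rm left}}^{1-t_{\rm right}}\omega(f,x,\epsilon)^{-1}dx,\qquad \underline N(f,\epsilon)=\Big\lceil \frac{\Lambda_{\rm avg}(f,\epsilon)}{4(1+\log(\omega_{\max}(f,\epsilon)/\omega_{\min}(f,\epsilon)))}-2\Big\rceil$$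 (if no $t\le\frac12$ satisfies $\Delta(f,\frac12,t)\ge\epsilon$, so that $t_{\rm left}=t_{\rm right}=\frac12$ and $\omega(f,\frac12,\epsilon)$ is undefined, the ratio $\omega_{\max}/\omega_{\min}$ is read as $1$, and $\underline N(f,\epsilon)=-1$). Let $b_0=2t_{\rm left}(f,\epsilon)$ and, for $i\ge1$, $t_i=\sup\{t\in[0,\frac{1-b_{i-1}}2]:\Delta(f,b_{i-1}+t,t)\le\epsilon\}$, $z_i=b_{i-1}+t_i$, $b_i=b_{i-1}+2t_i$. With $n$ the first index such that $b_n\ge1-2t_{\rm right}(f,\epsilon)$, put $N_{\rm pck}(f,\epsilon)=\max\{n-1,0\}$ and $I_i^\epsilon=[z_i-\omega(f,z_i,\epsilon),\,z_i+\omega(f,z_i,\epsilon)]$ for $1\le i\le N_{\rm pck}(f,\epsilon)$. The local alternative class is $$\mathcal G_{f,\epsilon}=\Big\{f+\sum_{i=1}^{N_{\rm pck}(f,\epsilon)}\mathsf b_i\,\mathbb I\{\cdot\in I_i^\epsilon\}\,(\mathrm{Sec}[f,I_i^\epsilon]-f)\;:\;\mathsf b\in\{0,1\}^{N_{\rm pck}(f,\epsilon)}\Big\}.$$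 **Sampling model.** An active algorithm $\mathsf{Alg}$ (possibly using internal randomization that is independent of the noise) chooses each design point $x_t\in[0,1]$ as a function of its internal randomness and of $(x_s,y_s)_{s<t}$, and observes $y_t=g(x_t)+w_t$, where $g$ is the unknown function and $w_1,w_2,\dots$ are i.i.d. $\mathcal N(0,\sigma^2)$, $\sigma\ge0$. Whether it stops after $t$ samples, and the function $\widehat f$ that it then returns, depend only on its internal randomness and on $(x_s,y_s)_{s\le t}$; $\tau\in\{0,1,2,\dots,\infty\}$ is the number of samples taken. Write $\Pr_{\mathsf{Alg},g}$ and $\mathbb E_{g,\mathsf{Alg}}$ for the resulting law and expectation, and $\|h\|_\infty=\sup_{x\in[0,1]}|h(x)|$. **Theorem.** There is a universal constant $c>0$ such that the following holds. Let $f_\star:[0,1]\to\mathbb R$ be convex and continuous, $\epsilon>0$, $\delta\in(0,1/3)$, $\sigma\ge0$, and let $\mathsf{Alg}$ be any active algorithm such that for all $g\in\mathcal G_{f_\star,2\epsilon}$ $$\Pr_{\mathsf{Alg},g}\big[\tau<\infty\text{ and }\|\widehat f-g\|_\infty<\epsilon\big]\ge1-\delta .$$ Then, with $N=\underline N(f_\star,2\epsilon)$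 (both bounds being read as trivial when $N\le 0$), $$\mathbb E_{f_\star,\mathsf{Alg}}[\tau]\ \ge\ c\,N\cdot\max\Big\{1,\frac{\sigma^2}{2\epsilon^2}\log(1/\delta)\Big\},$$ $$\frac1{|\mathcal G_{f_\star,2\epsilon}|}\sum_{g\in\mathcal G_{f_\star,2\epsilon}}\mathbb E_{g,\mathsf{Alg}}[\tau]\ \ge\ c\,N\cdot\max\Big\{1,\frac{\sigma^2}{2\epsilon^2}\log(N/\delta)\Big\}.$$ Both bounds also hold with $N=\max\{1,N_{\rm pck}(f_\star,2\epsilon)\}$, provided, in the case $N_{\rm pck}(f_\star,2\epsilon)=0$ (where $\mathcal G_{f_\star,2\epsilon}=\{f_\star\}$), that the correctness guarantee is also satisfied for $g=f_\star+2\epsilon$. -/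

import Mathlib

open MeasureTheory ProbabilityTheory Set
open scoped NNReal ENNReal

noncomputable section

namespace ConvexSampling

/-! ### Secants and the approximation modulus (functions on `[0,1]` are represented by `ℝ → ℝ`) -/

/-- The secant approximation of `f` on `[a, b]`, evaluated at `x`. -/
def sec (f : ℝ → ℝ) (a b x : ℝ) : ℝ :=
  (b - x) / (b - a) * f a + (x - a) / (b - a) * f b

/-- The error at the midpoint of the secant approximation of `f` on `[x - t, x + t]`. -/
def midErr (f : ℝ → ℝ) (x t : ℝ) : ℝ :=
  (f (x - t) + f (x + t)) / 2 - f x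

/-- The local approximation modulus: the least `t ∈ [0, min x (1 - x)]` with midpoint error at
least `ε`. -/
def omega (f : ℝ → ℝ) (ε x : ℝ) : ℝ :=
  sInf {t | t ∈ Icc 0 (min x (1 - x)) ∧ ε ≤ midErr f x t}

/-- Left approximation point; the infimum is taken in `[0, 1/2]`, hence it is `1/2` when no
`t ≤ 1/2` qualifies. -/
def tLeft (f : ℝ → ℝ) (ε : ℝ) : ℝ :=
  sInf (insert (1 / 2) {t | t ∈ Icc 0 (1 / 2) ∧ ε ≤ midErr f t t})

/-- Right approximation point; the infimum is taken in `[0, 1/2]`, hence it is `1/2` when no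
`t ≤ 1/2` qualifies. -/
def tRight (f : ℝ → ℝ) (ε : ℝ) : ℝ :=
  sInf (insert (1 / 2) {t | t ∈ Icc 0 (1 / 2) ∧ ε ≤ midErr f (1 - t) t})

/-- The average approximation modulus. -/
def lambdaAvg (f : ℝ → ℝ) (ε : ℝ) : ℝ :=
  1 + ∫ x in (tLeft f ε)..(1 - tRight f ε), (omega f ε x)⁻¹

/-- The maximum of the modulus over `[tLeft, 1 - tRight]`. -/
def omegaMax (f : ℝ → ℝ) (ε : ℝ) : ℝ :=
  sSup (omega f ε '' Icc (tLeft f ε) (1 - tRight f ε))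

/-- The minimum of the modulus over `[tLeft, 1 - tRight]`. -/
def omegaMin (f : ℝ → ℝ) (ε : ℝ) : ℝ :=
  sInf (omega f ε '' Icc (tLeft f ε) (1 - tRight f ε))

/-- The computable lower bound on the packing number (an integer, possibly `≤ 0`). -/
def nLower (f : ℝ → ℝ) (ε : ℝ) : ℤ :=
  ⌈lambdaAvg f ε / (4 * (1 + Real.log (omegaMax f ε / omegaMin f ε))) - 2⌉

/-! ### The explicit packing -/

/-- Half-length of the longest interval starting at `b` whose midpoint error is at most `ε`. -/
def packStep (f : ℝ → ℝ) (ε b : ℝ) : ℝ :=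
  sSup {t | t ∈ Icc 0 ((1 - b) / 2) ∧ midErr f (b + t) t ≤ ε}

/-- The successive interval endpoints `b₀ = 2 * tLeft`, `bᵢ₊₁ = bᵢ + 2 tᵢ₊₁`. -/
def packEnd (f : ℝ → ℝ) (ε : ℝ) : ℕ → ℝ
  | 0 => 2 * tLeft f ε
  | n + 1 => packEnd f ε n + 2 * packStep f ε (packEnd f ε n)

/-- The midpoint of the `i`-th interval (counted from `0`). -/
def packMid (f : ℝ → ℝ) (ε : ℝ) (i : ℕ) : ℝ :=
  packEnd f ε i + packStep f ε (packEnd f ε i)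

/-- The size of the packing: with `n` the first index such that `bₙ ≥ 1 - 2 * tRight`, the
first `n - 1` intervals are kept (none if `n = 0`). -/
def nPack (f : ℝ → ℝ) (ε : ℝ) : ℕ :=
  sInf {n : ℕ | 1 - 2 * tRight f ε ≤ packEnd f ε n} - 1

/-- Left endpoint of the `i`-th packing interval. -/
def packLo (f : ℝ → ℝ) (ε : ℝ) (i : ℕ) : ℝ :=
  packMid f ε i - omega f ε (packMid f ε i)

/-- Right endpoint of the `i`-th packing interval. -/
def packHi (f : ℝ → ℝ) (ε : ℝ) (i : ℕ) : ℝ :=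
  packMid f ε i + omega f ε (packMid f ε i)

/-- The alternative that replaces `f` by its secant on those packing intervals `i` for which
`b i` holds. -/
def localAlt (f : ℝ → ℝ) (ε : ℝ) (b : Fin (nPack f ε) → Bool) : ℝ → ℝ := fun x =>
  f x + ∑ i, if b i then
    (Icc (packLo f ε i) (packHi f ε i)).indicator
      (fun x => sec f (packLo f ε i) (packHi f ε i) x - f x) x else 0

open Classical in
/-- The local alternative class. -/
def altClass (f : ℝ → ℝ) (ε : ℝ) : Finset (ℝ → ℝ) :=
  Finset.univ.image (localAlt f ε)

/-! ### Active algorithms -/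

/-- The `L∞` distance on `[0,1]`, with values in `[0, ∞]`. -/
def supDist (f g : ℝ → ℝ) : ℝ≥0∞ :=
  ⨆ x ∈ Icc (0 : ℝ) 1, edist (f x) (g x)

/-- An active algorithm. All its internal randomization is carried by a seed in `U`; all its
decisions after `t` measurements depend only on the seed and on the pairs (design point,
measurement) seen so far. -/
structure ActiveAlgorithm (U : Type*) [MeasurableSpace U] where
  /-- the next design point -/
  design : (t : ℕ) → U × (Fin t → ℝ × ℝ) → ℝ
  design_mem : ∀ t p, design t p ∈ Icc (0 : ℝ) 1
  measurable_design : ∀ t, Measurable (design t)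
  /-- the situations in which the algorithm stops after `t` measurements -/
  halt : (t : ℕ) → Set (U × (Fin t → ℝ × ℝ))
  measurableSet_halt : ∀ t, MeasurableSet (halt t)
  /-- the function returned when stopping after `t` measurements -/
  estimate : (t : ℕ) → U × (Fin t → ℝ × ℝ) → ℝ → ℝ
  measurable_estimate : ∀ (t : ℕ) (g : ℝ → ℝ), ContinuousOn g (Icc 0 1) → ∀ r : ℝ≥0∞,
    MeasurableSet {p | supDist (estimate t p) g < r}

/-- The law of the seed and of the noise: the seed has law `ρ` and is independent of the noise
`w₀, w₁, …`, which is i.i.d. `N(0, σ²)` (identically zero when `σ = 0`). -/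
def noiseLaw {U : Type*} [MeasurableSpace U] (ρ : Measure U) (σ : ℝ≥0) :
    Measure (U × (ℕ → ℝ)) :=
  ρ.prod (Measure.infinitePi fun _ : ℕ => gaussianReal 0 (σ ^ 2))

namespace ActiveAlgorithm

variable {U : Type*} [MeasurableSpace U]

/-- The first `t` pairs (design point, measurement) when the unknown function is `g`, the seed
is `p.1` and the noise is `p.2`; a query at `x` in round `t` is answered by `g x + p.2 t`. -/
def history (alg : ActiveAlgorithm U) (g : ℝ → ℝ) (p : U × (ℕ → ℝ)) :
    (t : ℕ) → Fin t → ℝ × ℝ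
  | 0 => Fin.elim0
  | t + 1 =>
    Fin.snoc (α := fun _ => ℝ × ℝ) (history alg g p t)
      (alg.design t (p.1, history alg g p t),
        g (alg.design t (p.1, history alg g p t)) + p.2 t)

/-- The number of measurements taken before stopping (`⊤` if the algorithm never stops). -/
def tau (alg : ActiveAlgorithm U) (g : ℝ → ℝ) (p : U × (ℕ → ℝ)) : ℕ∞ :=
  ⨅ (t : ℕ) (_ : (p.1, alg.history g p t) ∈ alg.halt t), (t : ℕ∞)

/-- The expected number of measurements when the unknown function is `g`. -/
def expTau (alg : ActiveAlgorithm U) (ρ : Measure U) (σ : ℝ≥0) (g : ℝ → ℝ) : ℝ≥0∞ :=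
  ∫⁻ p, (alg.tau g p : ℝ≥0∞) ∂(noiseLaw ρ σ)

/-- When the unknown function is `g`, with probability at least `1 - δ` the algorithm stops and
returns a function at `L∞` distance less than `ε` from `g`. -/
def Correct (alg : ActiveAlgorithm U) (ρ : Measure U) (σ : ℝ≥0) (ε δ : ℝ) (g : ℝ → ℝ) : Prop :=
  ENNReal.ofReal (1 - δ) ≤ noiseLaw ρ σ
    {p | ∃ t : ℕ, alg.tau g p = t ∧
      supDist (alg.estimate t (p.1, alg.history g p t)) g < ENNReal.ofReal ε}

end ActiveAlgorithm

end ConvexSampling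

end

/-!
The lower bounds come from a packing of `[0, 1]` by intervals on which `f` has midpoint error
exactly `2 * ε`. Replacing `f` by its secant on any subset of these intervals yields alternatives
that are `2 * ε` apart, so a correct algorithm has to find out, for each interval, which of the
two versions it faces; and only measurements taken inside an interval carry information about that
interval.

*Geometry.* For convex `f` the midpoint error is monotone under inclusion of intervals
(`midErr_mono`), so that the modulus `omega` is `1`-Lipschitz (`omega_le_add`) and equals the
half-length of a packing interval at its midpoint (`packing_spec`). On each half of an interval
`omega` dominates both `omegaMin` and the distance to the nearer end, so the half contributes at
most `1 + log (omegaMax / omegaMin)` to the integral of `omega⁻¹`. Counting the halves yields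
`nLower_le_nPack`, and only the bounds in terms of the packing number remain.

*Information.* The number of measurements is at least the sum over the packing intervals of the
expected numbers of visits (`sum_expVisits_le_expTau`). If a run on `g` does not visit the set `D`
on which `g` and `g'` differ, then the same noise leads to the same outcome on `g'`; this forces a
constant expected number of visits whatever the noise level (`one_third_le_expVisits`). The bounds
that grow with `σ` use a change of measure on the noise: shifting the noise of each round by
`g - g'` at the design point, while the run on `g` continues, turns it into a run on `g'`, and the law
of the noise is recovered by reweighting with an explicit likelihood ratio
(`lintegral_noiseShift`), which is proved by integrating out one Gaussian coordinate at a time.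
The mean of the log-likelihood ratio is at most a multiple of the expected number of visits to `D`
(`entropy_le_expVisits`), and it is bounded below through the probabilities of the outcomes by
means of `exp (-z) ≥ exp (-a) * (1 + a - z)` (`le_integral_logRatio`). The run is cut at a finite
time `T` for this, and `T` tends to infinity at the end.

*The factor `log (N / δ)`.* Fix an alternative. In a run on it, the events that the output is
close to its `N` neighbours, each obtained by flipping one bit, are disjoint and have total
probability at most `δ`, whereas the `i`-th of them has probability at least `1 - δ` in a run on
the `i`-th neighbour. The entropies of the neighbours relative to the fixed alternative thus add
up to order `N * log (N / δ)` (`sum_expVisits_flipBit_ge`). In the sum over all alternatives,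
flipping a bit is a permutation, and every visit is counted once (`sum_flipBit_expVisits_le`).
-/

noncomputable section

namespace ConvexSampling

/-! ### Midpoint errors of convex functions -/

lemma secant_le {f : ℝ → ℝ} (hf : ConvexOn ℝ (Icc 0 1) f) {a b x : ℝ} (ha : 0 ≤ a) (hb : b ≤ 1)
    (hax : a ≤ x) (hxb : x ≤ b) : (b - a) * f x ≤ (b - x) * f a + (x - a) * f b := by
  rcases eq_or_lt_of_le (hax.trans hxb) with h | h
  · have h1 : x = a := le_antisymm (by linarith) hax
    subst h1; subst h; simp
  · have hba : 0 < b - a := by linarith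
    have hw : (b - x) / (b - a) + (x - a) / (b - a) = 1 := by field_simp; ring
    have := hf.2 (show a ∈ Icc (0 : ℝ) 1 from ⟨ha, by linarith⟩)
      (show b ∈ Icc (0 : ℝ) 1 from ⟨by linarith, hb⟩)
      (div_nonneg (sub_nonneg.2 hxb) hba.le) (div_nonneg (sub_nonneg.2 hax) hba.le) hw
    simp only [smul_eq_mul] at this
    have h2 : (b - x) / (b - a) * a + (x - a) / (b - a) * b = x := by field_simp; ring
    rw [h2] at this
    have h3 := mul_le_mul_of_nonneg_left this hba.le
    calc _ ≤ _ := h3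
      _ = _ := by field_simp

/-- Moving the right endpoint of an interval outwards increases the midpoint error. -/
lemma midErr_mono_right {f : ℝ → ℝ} (hf : ConvexOn ℝ (Icc 0 1) f) {l r' r : ℝ} (hl : 0 ≤ l)
    (hlr : l ≤ r') (hr : r' ≤ r) (h1 : r ≤ 1) :
    (f l + f r') / 2 - f ((l + r') / 2) ≤ (f l + f r) / 2 - f ((l + r) / 2) := by
  set m' := (l + r') / 2 with hm'
  set m := (l + r) / 2 with hm
  have a1 := secant_le hf (a := m') (b := r) (x := m) (by linarith) h1 (by linarith) (by linarith)
  have a2 := secant_le hf (a := m') (b := r) (x := r') (by linarith) h1 (by linarith) (by linarith)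
  rcases eq_or_lt_of_le (show m' ≤ r by linarith) with h | h
  · have : r' = r := by linarith
    subst this; exact le_rfl
  · have hr0 : 0 < r - m' := by linarith
    have key : (r - m') * (2 * f m + f r') ≤ (r - m') * (2 * f m' + f r) := by
      have e1 : 2 * (r - m) + (r - r') = 2 * (r - m') := by rw [hm, hm']; ring
      have e2 : 2 * (m - m') + (r' - m') = r - m' := by rw [hm, hm']; ring
      calc (r - m') * (2 * f m + f r') ≤ (2 * (r - m) + (r - r')) * f m'
            + (2 * (m - m') + (r' - m')) * f r := by nlinarith
        _ = _ := by rw [e1, e2]; ring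
    have := le_of_mul_le_mul_left key hr0
    linarith

lemma midErr_mono_left {f : ℝ → ℝ} (hf : ConvexOn ℝ (Icc 0 1) f) {l l' r : ℝ} (hl : 0 ≤ l)
    (hl' : l ≤ l') (hr : l' ≤ r) (h1 : r ≤ 1) :
    (f l' + f r) / 2 - f ((l' + r) / 2) ≤ (f l + f r) / 2 - f ((l + r) / 2) := by
  set m' := (l' + r) / 2 with hm'
  set m := (l + r) / 2 with hm
  have a1 := secant_le hf (a := l) (b := m') (x := m) hl (by linarith) (by linarith) (by linarith)
  have a2 := secant_le hf (a := l) (b := m') (x := l') hl (by linarith) (by linarith) (by linarith)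
  rcases eq_or_lt_of_le (show l ≤ m' by linarith) with h | h
  · have : l' = l := by linarith
    subst this; exact le_rfl
  · have hr0 : 0 < m' - l := by linarith
    have key : (m' - l) * (2 * f m + f l') ≤ (m' - l) * (2 * f m' + f l) := by
      have e1 : 2 * (m' - m) + (m' - l') = m' - l := by rw [hm, hm']; ring
      have e2 : 2 * (m - l) + (l' - l) = 2 * (m' - l) := by rw [hm, hm']; ring
      calc (m' - l) * (2 * f m + f l') ≤ (2 * (m' - m) + (m' - l')) * f l
            + (2 * (m - l) + (l' - l)) * f m' := by nlinarith
        _ = _ := by rw [e1, e2]; ring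
    have := le_of_mul_le_mul_left key hr0
    linarith

/-- The midpoint error of a convex function is monotone under inclusion of intervals. -/
lemma midErr_mono {f : ℝ → ℝ} (hf : ConvexOn ℝ (Icc 0 1) f) {x t y s : ℝ} (ht : 0 ≤ t)
    (h0 : 0 ≤ y - s) (hl : y - s ≤ x - t) (hr : x + t ≤ y + s) (h1 : y + s ≤ 1) :
    midErr f x t ≤ midErr f y s := by
  have a1 := midErr_mono_left hf (l := y - s) (l' := x - t) (r := x + t) h0 hl (by linarith)
    (by linarith)
  have a2 := midErr_mono_right hf (l := y - s) (r' := x + t) (r := y + s) h0 (by linarith) hr h1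
  have e1 : (x - t + (x + t)) / 2 = x := by ring
  have e2 : (y - s + (y + s)) / 2 = y := by ring
  rw [e1] at a1; rw [e2] at a2
  exact a1.trans a2

lemma mul_midErr_le {f : ℝ → ℝ} (hf : ConvexOn ℝ (Icc 0 1) f) {x s t : ℝ} (hs : 0 ≤ s)
    (hst : s ≤ t) (h0 : 0 ≤ x - t) (h1 : x + t ≤ 1) : t * midErr f x s ≤ s * midErr f x t := by
  rcases eq_or_lt_of_le (hs.trans hst) with h | h
  · have : s = 0 := by linarith
    subst this; subst h; simp
  have a1 := secant_le hf (a := x - t) (b := x + t) (x := x - s) h0 h1 (by linarith) (by linarith)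
  have a2 := secant_le hf (a := x - t) (b := x + t) (x := x + s) h0 h1 (by linarith) (by linarith)
  have a3 := secant_le hf (a := x) (b := x + t) (x := x + s) (by linarith) h1 (by linarith)
    (by linarith)
  have a4 := secant_le hf (a := x - t) (b := x) (x := x - s) h0 (by linarith) (by linarith)
    (by linarith)
  unfold midErr
  nlinarith

/-- A positive midpoint error strictly grows with the half-length of the interval. -/
lemma midErr_strict {f : ℝ → ℝ} (hf : ConvexOn ℝ (Icc 0 1) f) {x s t e : ℝ} (he : 0 < e)
    (hs : 0 ≤ s) (hst : s < t) (h0 : 0 ≤ x - t) (h1 : x + t ≤ 1) (hE : midErr f x t ≤ e) :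
    midErr f x s < e := by
  have := mul_midErr_le hf hs hst.le h0 h1
  have ht : 0 < t := by linarith
  by_contra hcon
  push Not at hcon
  nlinarith

lemma midErr_zero (f : ℝ → ℝ) (x : ℝ) : midErr f x 0 = 0 := by
  simp [midErr]

lemma continuousOn_midErr {f : ℝ → ℝ} (hc : ContinuousOn f (Icc 0 1)) {S : Set ℝ} {u : ℝ → ℝ}
    (hu : Continuous u) (hS : ∀ t ∈ S, 0 ≤ t ∧ 0 ≤ u t - t ∧ u t + t ≤ 1) :
    ContinuousOn (fun t => midErr f (u t) t) S := by
  unfold midErr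
  refine ((ContinuousOn.add ?_ ?_).div_const 2).sub ?_
  · exact hc.comp (by fun_prop) fun t ht => by
      obtain ⟨h1, h2, h3⟩ := hS t ht; constructor <;> linarith
  · exact hc.comp (by fun_prop) fun t ht => by
      obtain ⟨h1, h2, h3⟩ := hS t ht; constructor <;> linarith
  · exact hc.comp (by fun_prop) fun t ht => by
      obtain ⟨h1, h2, h3⟩ := hS t ht; constructor <;> linarith

/-! ### The local approximation modulus -/

/-- If the midpoint error at `x` equals `e > 0` for the half-length `t`, then `t` is the local
approximation modulus: by strict monotonicity, no smaller half-length reaches `e`. -/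
lemma omega_eq {f : ℝ → ℝ} (hf : ConvexOn ℝ (Icc 0 1) f) {e x t : ℝ} (he : 0 < e)
    (ht : 0 ≤ t) (h0 : 0 ≤ x - t) (h1 : x + t ≤ 1) (hE : midErr f x t = e) : omega f e x = t := by
  refine IsLeast.csInf_eq ⟨⟨⟨ht, le_min (by linarith) (by linarith)⟩, hE.ge⟩, ?_⟩
  rintro s ⟨⟨hs0, hs1⟩, hs⟩
  by_contra hcon
  push Not at hcon
  exact absurd (midErr_strict hf he hs0 hcon h0 h1 hE.le) (not_lt.2 hs)

lemma exists_midErr_eq {f : ℝ → ℝ} (hc : ContinuousOn f (Icc 0 1)) {e t : ℝ}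
    (he : 0 < e) {u : ℝ → ℝ} (hu : Continuous u) (ht0 : 0 ≤ t)
    (hS : ∀ s ∈ Icc 0 t, 0 ≤ u s - s ∧ u s + s ≤ 1) (hE : e ≤ midErr f (u t) t) :
    ∃ s ∈ Icc 0 t, midErr f (u s) s = e := by
  have := intermediate_value_Icc ht0 (continuousOn_midErr hc hu (S := Icc 0 t)
    fun s hs => ⟨hs.1, hS s hs⟩)
  have h2 := this ⟨by rw [midErr_zero]; exact he.le, hE⟩
  obtain ⟨s, hs, h⟩ := h2
  exact ⟨s, hs, h⟩

/-- Wherever some admissible interval centred at `x` has midpoint error at least `e`, the modulus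
is positive, admissible, and its midpoint error is exactly `e`. -/
lemma omega_spec {f : ℝ → ℝ} (hf : ConvexOn ℝ (Icc 0 1) f) (hc : ContinuousOn f (Icc 0 1))
    {e x t : ℝ} (he : 0 < e) (ht : 0 ≤ t) (h0 : 0 ≤ x - t) (h1 : x + t ≤ 1)
    (hE : e ≤ midErr f x t) :
    0 < omega f e x ∧ omega f e x ≤ t ∧ midErr f x (omega f e x) = e := by
  obtain ⟨s, hs, h⟩ := exists_midErr_eq hc he (u := fun _ => x) continuous_const ht
    (fun s hs => ⟨by linarith [hs.2], by linarith [hs.2]⟩) hE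
  have := omega_eq hf he hs.1 (by linarith [hs.2]) (by linarith [hs.2]) h
  rw [this]
  refine ⟨lt_of_le_of_ne hs.1 ?_, hs.2, h⟩
  rintro rfl
  rw [midErr_zero] at h
  linarith

section Approx

variable {f : ℝ → ℝ} {e : ℝ}

lemma tLeft_eq_half (hf : ConvexOn ℝ (Icc 0 1) f) (h : midErr f (1 / 2) (1 / 2) < e) :
    tLeft f e = 1 / 2 := by
  have : {t | t ∈ Icc (0 : ℝ) (1 / 2) ∧ e ≤ midErr f t t} = ∅ := by
    ext t
    simp only [mem_ofPred_eq, mem_Icc, mem_empty_iff_false, iff_false, not_and, not_le, and_imp]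
    intro h0 h1
    exact (midErr_mono hf h0 (by norm_num) (by linarith) (by linarith) (by norm_num)).trans_lt h
  rw [tLeft, this]; simp

lemma tRight_eq_half (hf : ConvexOn ℝ (Icc 0 1) f) (h : midErr f (1 / 2) (1 / 2) < e) :
    tRight f e = 1 / 2 := by
  have : {t | t ∈ Icc (0 : ℝ) (1 / 2) ∧ e ≤ midErr f (1 - t) t} = ∅ := by
    ext t
    simp only [mem_ofPred_eq, mem_Icc, mem_empty_iff_false, iff_false, not_and, not_le, and_imp]
    intro h0 h1
    exact (midErr_mono hf h0 (by norm_num) (by linarith) (by linarith) (by norm_num)).trans_lt h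
  rw [tRight, this]; simp

/-- The least `t` in `[0, 1/2]` at which the error of `[u t - t, u t + t]` reaches `e` is
attained, and there the error equals `e`. -/
lemma sInf_insert_half_spec (hc : ContinuousOn f (Icc 0 1)) (he : 0 < e) {u : ℝ → ℝ}
    (hu : Continuous u) (hS : ∀ s ∈ Icc (0 : ℝ) (1 / 2), 0 ≤ u s - s ∧ u s + s ≤ 1)
    (h : e ≤ midErr f (u (1 / 2)) (1 / 2)) :
    ∃ T, sInf (insert (1 / 2) {t | t ∈ Icc (0 : ℝ) (1 / 2) ∧ e ≤ midErr f (u t) t}) = T ∧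
      0 < T ∧ T ≤ 1 / 2 ∧ midErr f (u T) T = e ∧
      ∀ t ∈ Icc (0 : ℝ) (1 / 2), e ≤ midErr f (u t) t → T ≤ t := by
  have hcont := continuousOn_midErr hc hu (S := Icc (0 : ℝ) (1 / 2)) fun s hs => ⟨hs.1, hS s hs⟩
  have hclosed : IsClosed (Icc (0 : ℝ) (1 / 2) ∩ (fun t => midErr f (u t) t) ⁻¹' Ici e) :=
    hcont.preimage_isClosed_of_isClosed isClosed_Icc isClosed_Ici
  have hcomp : IsCompact (Icc (0 : ℝ) (1 / 2) ∩ (fun t => midErr f (u t) t) ⁻¹' Ici e) :=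
    isCompact_Icc.of_isClosed_subset hclosed inter_subset_left
  have hhalf : (1 / 2 : ℝ) ∈ Icc (0 : ℝ) (1 / 2) := ⟨by norm_num, le_rfl⟩
  obtain ⟨T, ⟨hT, hTe⟩, hmin⟩ := hcomp.exists_isLeast ⟨1 / 2, hhalf, h⟩
  have hmin' : ∀ t ∈ Icc (0 : ℝ) (1 / 2), e ≤ midErr f (u t) t → T ≤ t :=
    fun t ht hte => hmin ⟨ht, hte⟩
  obtain ⟨s, hs, hse⟩ := exists_midErr_eq hc he hu hT.1
    (fun s hs => hS s ⟨hs.1, hs.2.trans hT.2⟩) hTe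
  have hsT : s = T := le_antisymm hs.2 (hmin' s ⟨hs.1, hs.2.trans hT.2⟩ hse.ge)
  subst hsT
  refine ⟨s, IsLeast.csInf_eq ⟨Or.inr ⟨hT, hTe⟩, ?_⟩, lt_of_le_of_ne hT.1 ?_, hT.2, hse, hmin'⟩
  · rintro t (rfl | ⟨ht, hte⟩)
    · exact hT.2
    · exact hmin' t ht hte
  · rintro rfl
    rw [midErr_zero] at hse; linarith

lemma tLeft_spec (hc : ContinuousOn f (Icc 0 1)) (he : 0 < e)
    (h : e ≤ midErr f (1 / 2) (1 / 2)) :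
    0 < tLeft f e ∧ tLeft f e ≤ 1 / 2 ∧ midErr f (tLeft f e) (tLeft f e) = e ∧
      ∀ t ∈ Icc (0 : ℝ) (1 / 2), e ≤ midErr f t t → tLeft f e ≤ t := by
  obtain ⟨T, hT, h'⟩ := sInf_insert_half_spec hc he (u := fun t => t) continuous_id
    (fun s hs => ⟨by simp, by linarith [hs.2]⟩) h
  rw [tLeft, hT]
  exact h'

lemma tRight_spec (hc : ContinuousOn f (Icc 0 1)) (he : 0 < e)
    (h : e ≤ midErr f (1 / 2) (1 / 2)) :
    0 < tRight f e ∧ tRight f e ≤ 1 / 2 ∧ midErr f (1 - tRight f e) (tRight f e) = e ∧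
      ∀ t ∈ Icc (0 : ℝ) (1 / 2), e ≤ midErr f (1 - t) t → tRight f e ≤ t := by
  obtain ⟨T, hT, h'⟩ := sInf_insert_half_spec hc he (u := fun t => 1 - t) (by fun_prop)
    (fun s hs => ⟨by linarith [hs.2], by simp⟩) (by norm_num at h ⊢; exact h)
  rw [tRight, hT]
  exact h'

/-- On `[tLeft, 1 - tRight]` the modulus is well defined. -/
lemma omega_spec_of_mem (hf : ConvexOn ℝ (Icc 0 1) f) (hc : ContinuousOn f (Icc 0 1))
    (he : 0 < e) (h : e ≤ midErr f (1 / 2) (1 / 2)) {x : ℝ}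
    (hx : x ∈ Icc (tLeft f e) (1 - tRight f e)) :
    0 < omega f e x ∧ omega f e x ≤ x ∧ omega f e x ≤ 1 - x ∧ midErr f x (omega f e x) = e := by
  obtain ⟨l0, l1, l2, -⟩ := tLeft_spec hc he h
  obtain ⟨r0, r1, r2, -⟩ := tRight_spec hc he h
  rcases le_total x (1 / 2) with hx2 | hx2
  · obtain ⟨a, b, c⟩ := omega_spec hf hc he (x := x) (t := x) (by linarith [hx.1]) (by simp)
      (by linarith) (l2.ge.trans (midErr_mono hf l0.le (by simp) (by simp) (by linarith [hx.1])
        (by linarith)))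
    exact ⟨a, b, by linarith, c⟩
  · obtain ⟨a, b, c⟩ := omega_spec hf hc he (x := x) (t := 1 - x) (by linarith [hx.2])
      (by linarith) (by linarith) (r2.ge.trans (midErr_mono hf r0.le (by linarith)
        (by linarith [hx.2]) (by linarith) (by linarith)))
    exact ⟨a, by linarith, b, c⟩

/-- The modulus is `1`-Lipschitz, because an interval inside one of error less than `e` again has
error less than `e`. -/
lemma omega_le_add (hf : ConvexOn ℝ (Icc 0 1) f) (hc : ContinuousOn f (Icc 0 1))
    (he : 0 < e) (h : e ≤ midErr f (1 / 2) (1 / 2)) {x y : ℝ}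
    (hx : x ∈ Icc (tLeft f e) (1 - tRight f e)) (hy : y ∈ Icc (tLeft f e) (1 - tRight f e)) :
    omega f e x ≤ omega f e y + |x - y| := by
  obtain ⟨x1, x2, x3, x4⟩ := omega_spec_of_mem hf hc he h hx
  obtain ⟨y1, y2, y3, y4⟩ := omega_spec_of_mem hf hc he h hy
  by_contra hcon
  push Not at hcon
  have h0 := abs_nonneg (x - y)
  have h1 := le_abs_self (x - y)
  have h2 := neg_abs_le (x - y)
  have := midErr_strict hf he (by linarith) hcon (by linarith) (by linarith) x4.le
  have := midErr_mono hf (x := y) (t := omega f e y) (y := x) (s := omega f e y + |x - y|) y1.le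
    (by linarith) (by linarith) (by linarith) (by linarith)
  linarith

lemma continuousOn_omega (hf : ConvexOn ℝ (Icc 0 1) f) (hc : ContinuousOn f (Icc 0 1))
    (he : 0 < e) (h : e ≤ midErr f (1 / 2) (1 / 2)) :
    ContinuousOn (omega f e) (Icc (tLeft f e) (1 - tRight f e)) := by
  refine (LipschitzOnWith.of_dist_le_mul (K := 1) fun x hx y hy => ?_).continuousOn
  rw [Real.dist_eq, Real.dist_eq, NNReal.coe_one, one_mul, abs_sub_le_iff]
  have := omega_le_add hf hc he h hx hy
  have := omega_le_add hf hc he h hy hx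
  rw [abs_sub_comm y x] at this
  constructor <;> linarith

lemma omegaMin_pos_le (hf : ConvexOn ℝ (Icc 0 1) f) (hc : ContinuousOn f (Icc 0 1))
    (he : 0 < e) (h : e ≤ midErr f (1 / 2) (1 / 2)) :
    0 < omegaMin f e ∧ ∀ x ∈ Icc (tLeft f e) (1 - tRight f e),
      omegaMin f e ≤ omega f e x ∧ omega f e x ≤ omegaMax f e := by
  have hcont := continuousOn_omega hf hc he h
  have hcomp := isCompact_Icc.image_of_continuousOn hcont
  have hne : (Icc (tLeft f e) (1 - tRight f e)).Nonempty := by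
    have := tLeft_spec hc he h
    have := tRight_spec hc he h
    exact nonempty_Icc.2 (by linarith)
  have hmem := hcomp.sInf_mem (hne.image _)
  obtain ⟨x, hx, hxe⟩ := hmem
  refine ⟨?_, fun y hy => ⟨csInf_le hcomp.bddBelow ⟨y, hy, rfl⟩,
    le_csSup hcomp.bddAbove ⟨y, hy, rfl⟩⟩⟩
  rw [omegaMin, ← hxe]
  exact (omega_spec_of_mem hf hc he h hx).1

end Approx

/-! ### The packing -/

section Packing

variable {f : ℝ → ℝ} {e b : ℝ}

/-- The longest interval that starts at `b < 1 - 2 * tRight` with error at most `e` has error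
exactly `e` and a midpoint to the left of `1 - tRight`. -/
lemma packStep_spec (hf : ConvexOn ℝ (Icc 0 1) f) (hc : ContinuousOn f (Icc 0 1))
    (he : 0 < e) (h : e ≤ midErr f (1 / 2) (1 / 2)) (hb0 : 0 ≤ b) (hb : b < 1 - 2 * tRight f e) :
    0 < packStep f e b ∧ b + 2 * packStep f e b ≤ 1 ∧
      midErr f (b + packStep f e b) (packStep f e b) = e ∧
      b + packStep f e b ≤ 1 - tRight f e := by
  obtain ⟨r0, r1, r2, r3⟩ := tRight_spec hc he h
  have hdom : ∀ s ∈ Icc 0 ((1 - b) / 2), 0 ≤ b + s - s ∧ b + s + s ≤ 1 :=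
    fun s hs => ⟨by simpa using hb0, by linarith [hs.2]⟩
  have hend : e ≤ midErr f (b + (1 - b) / 2) ((1 - b) / 2) :=
    r2.ge.trans (midErr_mono hf r0.le (by linarith) (by linarith) (by linarith) (by linarith))
  obtain ⟨s, hs, hse⟩ := exists_midErr_eq hc he (u := fun t => b + t) (by fun_prop)
    (by linarith : 0 ≤ (1 - b) / 2) hdom hend
  have hclosed : IsClosed (Icc 0 ((1 - b) / 2) ∩ (fun t => midErr f (b + t) t) ⁻¹' Iic e) :=
    (continuousOn_midErr hc (by fun_prop) fun t ht => ⟨ht.1, hdom t ht⟩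
      ).preimage_isClosed_of_isClosed isClosed_Icc isClosed_Iic
  obtain ⟨T, ⟨hT, hTe⟩, hmax⟩ := (isCompact_Icc.of_isClosed_subset hclosed
    inter_subset_left).exists_isGreatest ⟨s, hs, hse.le⟩
  have hTeq : packStep f e b = T := IsGreatest.csSup_eq ⟨⟨hT, hTe⟩, hmax⟩
  rw [hTeq]
  have hsT : s ≤ T := hmax ⟨hs, hse.le⟩
  have hTe' : midErr f (b + T) T = e := le_antisymm hTe
    (hse.ge.trans (midErr_mono hf hs.1 (by linarith) (by linarith) (by linarith)
      (by linarith [hT.2])))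
  refine ⟨lt_of_le_of_ne hT.1 ?_, by linarith [hT.2], hTe', ?_⟩
  · rintro rfl
    rw [midErr_zero] at hTe'; linarith
  · by_contra hcon
    push Not at hcon
    have := r3 (1 - (b + T)) ⟨by linarith [hT.2, hT.1], by linarith⟩
      (hTe'.ge.trans (midErr_mono hf hT.1 (by linarith [hT.2]) (by linarith [hT.2])
        (by linarith [hT.2]) (by linarith [hT.2])))
    linarith

lemma packEnd_mono_bounds (hf : ConvexOn ℝ (Icc 0 1) f) (hc : ContinuousOn f (Icc 0 1))
    (he : 0 < e) (h : e ≤ midErr f (1 / 2) (1 / 2)) {n : ℕ}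
    (hn : ∀ k < n, packEnd f e k < 1 - 2 * tRight f e) :
    2 * tLeft f e + 2 * n * omegaMin f e ≤ packEnd f e n ∧
      ∀ k < n, packEnd f e k ≤ packEnd f e n := by
  obtain ⟨l0, l1, -⟩ := tLeft_spec hc he h
  obtain ⟨m0, m1⟩ := omegaMin_pos_le hf hc he h
  induction n with
  | zero => simp [packEnd]
  | succ n ih =>
    obtain ⟨i1, i2⟩ := ih fun k hk => hn k (by omega)
    have hpos : 0 ≤ 2 * n * omegaMin f e := by positivity
    obtain ⟨s0, s1, s2, s3⟩ := packStep_spec hf hc he h (b := packEnd f e n) (by linarith)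
      (hn n (by omega))
    have hom := omega_eq hf he s0.le (by linarith) (by linarith) s2
    have := (m1 _ ⟨by linarith, s3⟩).1
    rw [hom] at this
    have hstep : packEnd f e (n + 1) = packEnd f e n + 2 * packStep f e (packEnd f e n) := rfl
    refine ⟨by rw [hstep]; push_cast; linarith, fun k hk => ?_⟩
    rcases Nat.lt_succ_iff_lt_or_eq.1 hk with h' | rfl
    · linarith [i2 k h']
    · linarith

/-- Facts about the `i`-th interval of the packing construction, as long as it starts to the left
of `1 - 2 * tRight`. -/
lemma packInterval_spec (hf : ConvexOn ℝ (Icc 0 1) f) (hc : ContinuousOn f (Icc 0 1))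
    (he : 0 < e) (h : e ≤ midErr f (1 / 2) (1 / 2)) {i : ℕ}
    (hi : ∀ k ≤ i, packEnd f e k < 1 - 2 * tRight f e) :
    2 * tLeft f e ≤ packEnd f e i ∧ 0 < packStep f e (packEnd f e i) ∧
      packEnd f e (i + 1) ≤ 1 ∧ packMid f e i ≤ 1 - tRight f e ∧
      midErr f (packMid f e i) (packStep f e (packEnd f e i)) = e ∧
      omega f e (packMid f e i) = packStep f e (packEnd f e i) := by
  obtain ⟨l0, l1, -⟩ := tLeft_spec hc he h
  obtain ⟨m0, m1⟩ := omegaMin_pos_le hf hc he h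
  have h2 := (packEnd_mono_bounds hf hc he h (n := i) fun k hk => hi k hk.le).1
  have hpos : 0 ≤ 2 * i * omegaMin f e := by positivity
  obtain ⟨s0, s1, s2, s3⟩ := packStep_spec hf hc he h (b := packEnd f e i) (by linarith)
    (hi i le_rfl)
  exact ⟨by linarith, s0, s1, s3, s2,
    omega_eq hf he s0.le (by simp only [packMid]; linarith) (by simp only [packMid]; linarith) s2⟩

/-- The packing construction reaches `1 - 2 * tRight`, since each step advances by at least
`2 * omegaMin`. -/
lemma exists_packEnd_ge (hf : ConvexOn ℝ (Icc 0 1) f) (hc : ContinuousOn f (Icc 0 1))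
    (he : 0 < e) (h : e ≤ midErr f (1 / 2) (1 / 2)) :
    {n : ℕ | 1 - 2 * tRight f e ≤ packEnd f e n}.Nonempty := by
  by_contra hcon
  rw [Set.not_nonempty_iff_eq_empty] at hcon
  have hall : ∀ n, packEnd f e n < 1 - 2 * tRight f e := by
    intro n
    by_contra h'
    push Not at h'
    have : n ∈ {n : ℕ | 1 - 2 * tRight f e ≤ packEnd f e n} := h'
    rw [hcon] at this
    exact this
  obtain ⟨m0, -⟩ := omegaMin_pos_le hf hc he h
  obtain ⟨l0, -⟩ := tLeft_spec hc he h
  obtain ⟨r0, -⟩ := tRight_spec hc he h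
  obtain ⟨n, hn⟩ := exists_nat_gt (1 / omegaMin f e)
  have := (packEnd_mono_bounds hf hc he h (n := n) fun k _ => hall k).1
  have h1 := hall n
  rw [div_lt_iff₀ m0] at hn
  linarith

lemma nPack_eq_zero (hf : ConvexOn ℝ (Icc 0 1) f) (h : midErr f (1 / 2) (1 / 2) < e) :
    nPack f e = 0 := by
  have : sInf {n : ℕ | 1 - 2 * tRight f e ≤ packEnd f e n} = 0 := by
    refine Nat.sInf_eq_zero.2 (Or.inl ?_)
    simp only [mem_ofPred_eq, packEnd]
    rw [tLeft_eq_half hf h, tRight_eq_half hf h]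
    norm_num
  rw [nPack, this]

/-- The intervals of the packing: they are the consecutive intervals `[packEnd i, packEnd (i + 1)]`,
and `f` has midpoint error exactly `e` on each of them. -/
lemma packing_spec (hf : ConvexOn ℝ (Icc 0 1) f) (hc : ContinuousOn f (Icc 0 1))
    (he : 0 < e) {i : ℕ} (hi : i < nPack f e) :
    packLo f e i = packEnd f e i ∧ packHi f e i = packEnd f e (i + 1) ∧
      0 ≤ packLo f e i ∧ packHi f e i ≤ 1 ∧ packLo f e i < packMid f e i ∧
      packMid f e i < packHi f e i ∧ packMid f e i = (packLo f e i + packHi f e i) / 2 ∧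
      (f (packLo f e i) + f (packHi f e i)) / 2 - f (packMid f e i) = e := by
  have h : e ≤ midErr f (1 / 2) (1 / 2) := by
    by_contra hcon
    rw [nPack_eq_zero hf (not_le.1 hcon)] at hi
    omega
  have hlt : ∀ k ≤ i, packEnd f e k < 1 - 2 * tRight f e := by
    intro k hk
    have : k < sInf {n : ℕ | 1 - 2 * tRight f e ≤ packEnd f e n} := by
      unfold nPack at hi; omega
    exact not_le.1 (Nat.notMem_of_lt_sInf this)
  obtain ⟨a1, a2, a3, a4, a5, a6⟩ := packInterval_spec hf hc he h hlt
  obtain ⟨l0, -⟩ := tLeft_spec hc he h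
  have e1 : packLo f e i = packEnd f e i := by rw [packLo, a6, packMid]; ring
  have e2 : packHi f e i = packEnd f e (i + 1) := by rw [packHi, a6, packMid, packEnd]; ring
  have e3 : packHi f e i = packMid f e i + packStep f e (packEnd f e i) := by rw [packHi, a6]
  have e4 : packLo f e i = packMid f e i - packStep f e (packEnd f e i) := by rw [packLo, a6]
  refine ⟨e1, e2, by linarith, by linarith, by linarith, by linarith, by linarith, ?_⟩
  rw [e3, e4]
  exact a5

/-- Distinct packing intervals have disjoint interiors. -/
lemma packing_separated (hf : ConvexOn ℝ (Icc 0 1) f) (hc : ContinuousOn f (Icc 0 1))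
    (he : 0 < e) {i j : ℕ} (hij : i < j) (hj : j < nPack f e) :
    packHi f e i ≤ packLo f e j := by
  induction j, hij using Nat.le_induction with
  | base =>
    rw [(packing_spec hf hc he (show i < nPack f e by omega)).2.1, (packing_spec hf hc he hj).1]
  | succ k hk ih =>
    have h1 := ih (by omega)
    obtain ⟨-, a2, -, -, a3, a4, -⟩ := packing_spec hf hc he (show k < nPack f e by omega)
    rw [(packing_spec hf hc he hj).1, ← a2]
    linarith

end Packing

/-! ### The integral of the inverse modulus -/

lemma integral_inv_max_le {m M p q : ℝ} (hm : 0 < m) (hM : m ≤ M) (hp : 0 ≤ p) (hpq : p ≤ q)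
    (hq : q ≤ M) : ∫ u in p..q, (max m u)⁻¹ ≤ 1 + Real.log (M / m) := by
  have hcont : Continuous fun u : ℝ => (max m u)⁻¹ :=
    Continuous.inv₀ (by fun_prop) fun u => (lt_max_of_lt_left hm).ne'
  have hint : ∀ a b : ℝ, IntervalIntegrable (fun u : ℝ => (max m u)⁻¹) volume a b :=
    fun a b => hcont.intervalIntegrable a b
  refine (intervalIntegral.integral_mono_interval hp hpq hq
    (Filter.Eventually.of_forall fun u => inv_nonneg.2 (hm.le.trans (le_max_left _ _)))
    (hint 0 M)).trans ?_
  rw [← intervalIntegral.integral_add_adjacent_intervals (hint 0 m) (hint m M)]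
  have h1 : ∫ u in (0 : ℝ)..m, (max m u)⁻¹ = 1 := by
    rw [intervalIntegral.integral_congr (g := fun _ => m⁻¹)]
    · simp [hm.ne']
    · intro u hu
      rw [uIcc_of_le hm.le] at hu
      simp [max_eq_left hu.2]
  have h2 : ∫ u in m..M, (max m u)⁻¹ = Real.log (M / m) := by
    rw [← integral_inv_of_pos hm (hm.trans_le hM)]
    refine intervalIntegral.integral_congr fun u hu => ?_
    rw [uIcc_of_le hM] at hu
    simp [max_eq_right hu.1]
  rw [h1, h2]

/-- A function that is at least `m` and dominates the distance to `c` contributes at most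
`1 + log (M / m)` to the integral of its inverse over an interval to the left of `c`. -/
lemma integral_inv_le_of_right {g : ℝ → ℝ} {m M a b c : ℝ} (hm : 0 < m) (hM : m ≤ M)
    (hab : a ≤ b) (hbc : b ≤ c) (hca : c - a ≤ M) (hg : ContinuousOn g (Icc a b))
    (h : ∀ x ∈ Icc a b, m ≤ g x ∧ c - x ≤ g x) :
    ∫ x in a..b, (g x)⁻¹ ≤ 1 + Real.log (M / m) := by
  have hcont : Continuous fun x : ℝ => (max m (c - x))⁻¹ :=
    Continuous.inv₀ (by fun_prop) fun u => (lt_max_of_lt_left hm).ne'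
  calc ∫ x in a..b, (g x)⁻¹ ≤ ∫ x in a..b, (max m (c - x))⁻¹ := by
        refine intervalIntegral.integral_mono_on hab ?_ (hcont.intervalIntegrable _ _) ?_
        · rw [← uIcc_of_le hab] at hg
          refine (hg.inv₀ fun x hx => ?_).intervalIntegrable
          rw [uIcc_of_le hab] at hx
          exact (hm.trans_le (h x hx).1).ne'
        · intro x hx
          exact inv_anti₀ (lt_max_of_lt_left hm) (max_le (h x hx).1 (h x hx).2)
    _ = ∫ u in (c - b)..(c - a), (max m u)⁻¹ :=
        intervalIntegral.integral_comp_sub_left (fun u => (max m u)⁻¹) c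
    _ ≤ _ := integral_inv_max_le hm hM (by linarith) (by linarith) hca

lemma integral_inv_le_of_left {g : ℝ → ℝ} {m M a b c : ℝ} (hm : 0 < m) (hM : m ≤ M)
    (hab : a ≤ b) (hca : c ≤ a) (hbc : b - c ≤ M) (hg : ContinuousOn g (Icc a b))
    (h : ∀ x ∈ Icc a b, m ≤ g x ∧ x - c ≤ g x) :
    ∫ x in a..b, (g x)⁻¹ ≤ 1 + Real.log (M / m) := by
  have hcont : Continuous fun x : ℝ => (max m (x - c))⁻¹ :=
    Continuous.inv₀ (by fun_prop) fun u => (lt_max_of_lt_left hm).ne'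
  calc ∫ x in a..b, (g x)⁻¹ ≤ ∫ x in a..b, (max m (x - c))⁻¹ := by
        refine intervalIntegral.integral_mono_on hab ?_ (hcont.intervalIntegrable _ _) ?_
        · rw [← uIcc_of_le hab] at hg
          refine (hg.inv₀ fun x hx => ?_).intervalIntegrable
          rw [uIcc_of_le hab] at hx
          exact (hm.trans_le (h x hx).1).ne'
        · intro x hx
          exact inv_anti₀ (lt_max_of_lt_left hm) (max_le (h x hx).1 (h x hx).2)
    _ = ∫ u in (a - c)..(b - c), (max m u)⁻¹ :=
        intervalIntegral.integral_comp_sub_right (fun u => (max m u)⁻¹) c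
    _ ≤ _ := integral_inv_max_le hm hM (by linarith) (by linarith) hbc

section

variable {f : ℝ → ℝ} {e : ℝ}

lemma intervalIntegrable_inv_omega (hf : ConvexOn ℝ (Icc 0 1) f) (hc : ContinuousOn f (Icc 0 1))
    (he : 0 < e) (h : e ≤ midErr f (1 / 2) (1 / 2)) {a b : ℝ}
    (ha : a ∈ Icc (tLeft f e) (1 - tRight f e)) (hb : b ∈ Icc (tLeft f e) (1 - tRight f e)) :
    IntervalIntegrable (fun x => (omega f e x)⁻¹) volume a b := by
  have hsub : uIcc a b ⊆ Icc (tLeft f e) (1 - tRight f e) := uIcc_subset_Icc ha hb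
  exact (((continuousOn_omega hf hc he h).mono hsub).inv₀ fun x hx =>
    (omega_spec_of_mem hf hc he h (hsub hx)).1.ne').intervalIntegrable

/-- To the right of a point `a`, up to distance `omega a`, the integral of `omega⁻¹` is at most
`1 + log (omegaMax / omegaMin)`. -/
lemma integral_inv_omega_right_le (hf : ConvexOn ℝ (Icc 0 1) f) (hc : ContinuousOn f (Icc 0 1))
    (he : 0 < e) (h : e ≤ midErr f (1 / 2) (1 / 2)) {a b : ℝ}
    (ha : a ∈ Icc (tLeft f e) (1 - tRight f e)) (hb : b ∈ Icc (tLeft f e) (1 - tRight f e))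
    (hab : a ≤ b) (hba : b ≤ a + omega f e a) :
    ∫ x in a..b, (omega f e x)⁻¹ ≤ 1 + Real.log (omegaMax f e / omegaMin f e) := by
  obtain ⟨m0, m1⟩ := omegaMin_pos_le hf hc he h
  have hsub : Icc a b ⊆ Icc (tLeft f e) (1 - tRight f e) := Icc_subset_Icc ha.1 hb.2
  refine integral_inv_le_of_right (c := a + omega f e a) m0 ((m1 a ha).1.trans (m1 a ha).2) hab hba
    (by linarith [(m1 a ha).2]) ((continuousOn_omega hf hc he h).mono hsub) fun x hx => ?_
  refine ⟨(m1 x (hsub hx)).1, ?_⟩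
  have := omega_le_add hf hc he h ha (hsub hx)
  rw [abs_sub_comm, abs_of_nonneg (by linarith [hx.1])] at this
  linarith

lemma integral_inv_omega_left_le (hf : ConvexOn ℝ (Icc 0 1) f) (hc : ContinuousOn f (Icc 0 1))
    (he : 0 < e) (h : e ≤ midErr f (1 / 2) (1 / 2)) {a b : ℝ}
    (ha : a ∈ Icc (tLeft f e) (1 - tRight f e)) (hb : b ∈ Icc (tLeft f e) (1 - tRight f e))
    (hab : a ≤ b) (hba : b - omega f e b ≤ a) :
    ∫ x in a..b, (omega f e x)⁻¹ ≤ 1 + Real.log (omegaMax f e / omegaMin f e) := by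
  obtain ⟨m0, m1⟩ := omegaMin_pos_le hf hc he h
  have hsub : Icc a b ⊆ Icc (tLeft f e) (1 - tRight f e) := Icc_subset_Icc ha.1 hb.2
  refine integral_inv_le_of_left (c := b - omega f e b) m0 ((m1 b hb).1.trans (m1 b hb).2) hab hba
    (by linarith [(m1 b hb).2]) ((continuousOn_omega hf hc he h).mono hsub) fun x hx => ?_
  refine ⟨(m1 x (hsub hx)).1, ?_⟩
  have := omega_le_add hf hc he h hb (hsub hx)
  rw [abs_of_nonneg (by linarith [hx.2])] at this
  linarith

/-- Up to the end of the `k`-th interval of the construction, but not beyond `1 - 2 * tRight`, the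
integral of `omega⁻¹` is at most `1 + 2 * k` times `1 + log (omegaMax / omegaMin)`: the interval
`[tLeft, 2 * tLeft]` and each half of an interval contribute at most one such term. -/
lemma integral_inv_omega_packEnd_le (hf : ConvexOn ℝ (Icc 0 1) f)
    (hc : ContinuousOn f (Icc 0 1)) (he : 0 < e) (h : e ≤ midErr f (1 / 2) (1 / 2)) {k : ℕ}
    (hk : ∀ j < k, packEnd f e j < 1 - 2 * tRight f e) {y : ℝ} (hy : tLeft f e ≤ y)
    (hy1 : y ≤ packEnd f e k) (hy2 : y ≤ 1 - tRight f e) :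
    ∫ x in (tLeft f e)..y, (omega f e x)⁻¹
      ≤ (1 + 2 * k) * (1 + Real.log (omegaMax f e / omegaMin f e)) := by
  obtain ⟨l0, l1, l2, -⟩ := tLeft_spec hc he h
  obtain ⟨r0, r1, -⟩ := tRight_spec hc he h
  obtain ⟨m0, m1⟩ := omegaMin_pos_le hf hc he h
  have hL : tLeft f e ∈ Icc (tLeft f e) (1 - tRight f e) := ⟨le_rfl, by linarith⟩
  have hlog : 0 ≤ Real.log (omegaMax f e / omegaMin f e) :=
    Real.log_nonneg ((one_le_div m0).2 ((m1 _ hL).1.trans (m1 _ hL).2))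
  induction k generalizing y with
  | zero =>
    have hom : omega f e (tLeft f e) = tLeft f e :=
      omega_eq hf he l0.le (by simp) (by linarith) l2
    have := integral_inv_omega_right_le hf hc he h hL ⟨hy, hy2⟩ hy
      (by rw [hom]; simpa [packEnd, two_mul] using hy1)
    simpa using this
  | succ k ih =>
    have hk' : ∀ j < k, packEnd f e j < 1 - 2 * tRight f e := fun j hj => hk j (by omega)
    rcases le_total y (packEnd f e k) with hyk | hyk
    · refine (ih hk' hy hyk hy2).trans ?_
      push_cast
      nlinarith
    · obtain ⟨a1, a2, a3, a4, a5, a6⟩ := packInterval_spec hf hc he h (i := k)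
        fun j hj => hk j (by omega)
      have hstep : packEnd f e (k + 1) = packEnd f e k + 2 * packStep f e (packEnd f e k) := rfl
      have hmid : packMid f e k = packEnd f e k + packStep f e (packEnd f e k) := rfl
      have hB : packEnd f e k ∈ Icc (tLeft f e) (1 - tRight f e) := ⟨by linarith, by linarith⟩
      have hZ : packMid f e k ∈ Icc (tLeft f e) (1 - tRight f e) := ⟨by linarith, a4⟩
      have hY : y ∈ Icc (tLeft f e) (1 - tRight f e) := ⟨hy, hy2⟩
      have hI := intervalIntegrable_inv_omega hf hc he h hL hB
      have i0 := ih hk' hB.1 le_rfl hB.2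
      rw [← intervalIntegral.integral_add_adjacent_intervals hI
        (intervalIntegrable_inv_omega hf hc he h hB hY)]
      have i1 : ∫ x in (packEnd f e k)..y, (omega f e x)⁻¹
          ≤ 2 * (1 + Real.log (omegaMax f e / omegaMin f e)) := by
        rcases le_total y (packMid f e k) with hyz | hyz
        · have hmono : ∫ x in (packEnd f e k)..y, (omega f e x)⁻¹ ≤
              ∫ x in (packEnd f e k)..(packMid f e k), (omega f e x)⁻¹ := by
            rw [← intervalIntegral.integral_add_adjacent_intervals
              (intervalIntegrable_inv_omega hf hc he h hB hY)
              (intervalIntegrable_inv_omega hf hc he h hY hZ)]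
            have : 0 ≤ ∫ x in y..(packMid f e k), (omega f e x)⁻¹ :=
              intervalIntegral.integral_nonneg hyz fun x hx => inv_nonneg.2
                (m0.le.trans (m1 x ⟨hy.trans hx.1, hx.2.trans a4⟩).1)
            linarith
          have := integral_inv_omega_left_le hf hc he h hB hZ (by linarith) (by linarith)
          linarith
        · rw [← intervalIntegral.integral_add_adjacent_intervals
            (intervalIntegrable_inv_omega hf hc he h hB hZ)
            (intervalIntegrable_inv_omega hf hc he h hZ hY)]
          have := integral_inv_omega_left_le hf hc he h hB hZ (by linarith) (by linarith)
          have := integral_inv_omega_right_le hf hc he h hZ hY hyz (by linarith)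
          linarith
      push_cast
      linarith

/-- The computable quantity `nLower` is a lower bound on the packing number. -/
lemma nLower_le_nPack (hf : ConvexOn ℝ (Icc 0 1) f) (hc : ContinuousOn f (Icc 0 1))
    (he : 0 < e) : nLower f e ≤ nPack f e := by
  rw [nLower, Int.ceil_le, Int.cast_natCast]
  rcases lt_or_ge (midErr f (1 / 2) (1 / 2)) e with h | h
  · -- here `omega (1 / 2)` is the infimum of the empty set, and the ratio is `0 / 0 = 0`
    have hom : omega f e (1 / 2) = 0 := by
      have : {t | t ∈ Icc 0 (min (1 / 2 : ℝ) (1 - 1 / 2)) ∧ e ≤ midErr f (1 / 2) t} = ∅ := by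
        ext t
        simp only [mem_ofPred_eq, mem_Icc, mem_empty_iff_false, iff_false, not_and, not_le, and_imp,
          le_min_iff]
        intro h0 h1 _
        exact (midErr_mono hf h0 (by norm_num) (by linarith) (by linarith) (by norm_num)).trans_lt h
      rw [omega, this, Real.sInf_empty]
    have hpt : Icc (tLeft f e) (1 - tRight f e) = {1 / 2} := by
      rw [tLeft_eq_half hf h, tRight_eq_half hf h]; norm_num
    have h1 : omegaMin f e = 0 := by rw [omegaMin, hpt]; simpa using hom
    have h2 : lambdaAvg f e = 1 := by
      rw [lambdaAvg, tLeft_eq_half hf h, tRight_eq_half hf h]; norm_num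
    rw [h1, h2, nPack_eq_zero hf h]
    norm_num
  · obtain ⟨l0, l1, l2, -⟩ := tLeft_spec hc he h
    obtain ⟨r0, r1, r2, -⟩ := tRight_spec hc he h
    obtain ⟨m0, m1⟩ := omegaMin_pos_le hf hc he h
    have hL : tLeft f e ∈ Icc (tLeft f e) (1 - tRight f e) := ⟨le_rfl, by linarith⟩
    have hR : 1 - tRight f e ∈ Icc (tLeft f e) (1 - tRight f e) := ⟨by linarith, le_rfl⟩
    have hlog : 0 ≤ Real.log (omegaMax f e / omegaMin f e) :=
      Real.log_nonneg ((one_le_div m0).2 ((m1 _ hL).1.trans (m1 _ hL).2))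
    set n := sInf {n : ℕ | 1 - 2 * tRight f e ≤ packEnd f e n} with hn
    have hmem : 1 - 2 * tRight f e ≤ packEnd f e n := Nat.sInf_mem (exists_packEnd_ge hf hc he h)
    have hlt : ∀ j < n, packEnd f e j < 1 - 2 * tRight f e :=
      fun j hj => not_le.1 (Nat.notMem_of_lt_sInf hj)
    set y := max (tLeft f e) (1 - 2 * tRight f e) with hy
    have hLy : tLeft f e ≤ packEnd f e n := by
      have := (packEnd_mono_bounds hf hc he h hlt).1
      have : 0 ≤ 2 * n * omegaMin f e := by positivity
      linarith
    have hyR : y ≤ 1 - tRight f e := max_le hL.2 (by linarith)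
    have hY : y ∈ Icc (tLeft f e) (1 - tRight f e) := ⟨le_max_left _ _, hyR⟩
    have i1 := integral_inv_omega_packEnd_le hf hc he h hlt hY.1 (max_le hLy hmem) hyR
    have hom : omega f e (1 - tRight f e) = tRight f e :=
      omega_eq hf he r0.le (by linarith) (by simp) r2
    have i2 := integral_inv_omega_left_le hf hc he h hY hR hyR
      (by rw [hom]; exact le_trans (by linarith) (le_max_right (tLeft f e) _))
    have i3 := intervalIntegral.integral_add_adjacent_intervals
      (intervalIntegrable_inv_omega hf hc he h hL hY)
      (intervalIntegrable_inv_omega hf hc he h hY hR)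
    have hpk : (n : ℝ) ≤ nPack f e + 1 := by
      have : n ≤ nPack f e + 1 := by rw [nPack]; omega
      exact_mod_cast this
    rw [sub_le_iff_le_add, div_le_iff₀ (by positivity), lambdaAvg, ← i3]
    nlinarith
end

/-! ### The local alternatives -/

section Alternatives

lemma sec_left {f : ℝ → ℝ} {l r : ℝ} (h : l < r) : sec f l r l = f l := by
  have : r - l ≠ 0 := by linarith
  simp [sec, this]

lemma sec_right {f : ℝ → ℝ} {l r : ℝ} (h : l < r) : sec f l r r = f r := by
  have : r - l ≠ 0 := by linarith
  simp [sec, this]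

lemma le_sec {f : ℝ → ℝ} (hf : ConvexOn ℝ (Icc 0 1) f) {l r x : ℝ} (h0 : 0 ≤ l) (h1 : r ≤ 1)
    (hlr : l < r) (hx : x ∈ Icc l r) : f x ≤ sec f l r x := by
  have := secant_le hf h0 h1 hx.1 hx.2
  have hlr' : 0 < r - l := by linarith
  have h2 : sec f l r x = ((r - x) * f l + (x - l) * f r) / (r - l) := by
    rw [sec]; ring
  rw [h2, le_div_iff₀ hlr']
  linarith

/-- The error of a secant is at most twice its error at the midpoint, because it is a nonnegative
concave function of the position. -/
lemma sec_sub_le {f : ℝ → ℝ} (hf : ConvexOn ℝ (Icc 0 1) f) {l r x : ℝ} (h0 : 0 ≤ l) (h1 : r ≤ 1)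
    (hlr : l < r) (hx : x ∈ Icc l r) :
    sec f l r x - f x ≤ 2 * ((f l + f r) / 2 - f ((l + r) / 2)) := by
  have hlr' : 0 < r - l := by linarith
  have h2 : sec f l r x = ((r - x) * f l + (x - l) * f r) / (r - l) := by
    rw [sec]; ring
  have hs := le_sec hf h0 h1 hlr hx
  rcases le_total x ((l + r) / 2) with hm | hm
  · have a := secant_le hf (a := x) (b := r) (x := (l + r) / 2) (by linarith [hx.1]) h1 hm
      (by linarith)
    have hs' := hs
    rw [h2, le_div_iff₀ hlr'] at hs'
    have b : (r - l) * f x + (r - l) * (2 * ((f l + f r) / 2 - f ((l + r) / 2)))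
        ≥ (r - x) * f l + (x - l) * f r := by
      have hrx : 0 < r - x := by linarith
      refine le_of_mul_le_mul_left ?_ hrx
      nlinarith [mul_nonneg (sub_nonneg.2 hx.1) (sub_nonneg.2 hs')]
    rw [h2, sub_le_iff_le_add, div_le_iff₀ hlr']
    linarith
  · have a := secant_le hf (a := l) (b := x) (x := (l + r) / 2) h0 (by linarith [hx.2])
      (by linarith) hm
    have hs' := hs
    rw [h2, le_div_iff₀ hlr'] at hs'
    have b : (r - l) * f x + (r - l) * (2 * ((f l + f r) / 2 - f ((l + r) / 2)))
        ≥ (r - x) * f l + (x - l) * f r := by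
      have hrx : 0 < x - l := by linarith
      refine le_of_mul_le_mul_left ?_ hrx
      nlinarith [mul_nonneg (sub_nonneg.2 hx.2) (sub_nonneg.2 hs')]
    rw [h2, sub_le_iff_le_add, div_le_iff₀ hlr']
    linarith

variable {f : ℝ → ℝ} {e : ℝ}

/-- The difference between the secant and `f` on the `i`-th packing interval, extended by `0`. -/
def bump (f : ℝ → ℝ) (e : ℝ) (i : ℕ) : ℝ → ℝ :=
  (Icc (packLo f e i) (packHi f e i)).indicator
    (fun x => sec f (packLo f e i) (packHi f e i) x - f x)

lemma localAlt_apply (b : Fin (nPack f e) → Bool) (x : ℝ) :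
    localAlt f e b x = f x + ∑ i, if b i then bump f e i x else 0 := rfl

/-- The interior of the `i`-th packing interval: the only place where the `i`-th bit matters. -/
def packInt (f : ℝ → ℝ) (e : ℝ) (i : ℕ) : Set ℝ := Ioo (packLo f e i) (packHi f e i)

lemma bump_eq_zero (hf : ConvexOn ℝ (Icc 0 1) f) (hc : ContinuousOn f (Icc 0 1))
    (he : 0 < e) {i : ℕ} (hi : i < nPack f e) {x : ℝ} (hx : x ∉ packInt f e i) :
    bump f e i x = 0 := by
  obtain ⟨-, -, h0, h1, hl, hr, -⟩ := packing_spec hf hc he hi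
  rw [bump]
  by_cases hmem : x ∈ Icc (packLo f e i) (packHi f e i)
  · rw [indicator_of_mem hmem]
    rcases eq_or_lt_of_le hmem.1 with h | h
    · rw [← h, sec_left (hl.trans hr), sub_self]
    · rcases eq_or_lt_of_le hmem.2 with h' | h'
      · rw [h', sec_right (hl.trans hr), sub_self]
      · exact absurd ⟨h, h'⟩ hx
  · rw [indicator_of_notMem hmem]

lemma bump_nonneg_le (hf : ConvexOn ℝ (Icc 0 1) f) (hc : ContinuousOn f (Icc 0 1))
    (he : 0 < e) {i : ℕ} (hi : i < nPack f e) (x : ℝ) :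
    0 ≤ bump f e i x ∧ bump f e i x ≤ 2 * e := by
  obtain ⟨-, -, h0, h1, hl, hr, hm, hE⟩ := packing_spec hf hc he hi
  rw [bump]
  by_cases hmem : x ∈ Icc (packLo f e i) (packHi f e i)
  · rw [indicator_of_mem hmem]
    have := sec_sub_le hf h0 h1 (hl.trans hr) hmem
    rw [← hm, hE] at this
    exact ⟨sub_nonneg.2 (le_sec hf h0 h1 (hl.trans hr) hmem), this⟩
  · rw [indicator_of_notMem hmem]
    exact ⟨le_rfl, by linarith⟩

lemma bump_packMid (hf : ConvexOn ℝ (Icc 0 1) f) (hc : ContinuousOn f (Icc 0 1))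
    (he : 0 < e) {i : ℕ} (hi : i < nPack f e) : bump f e i (packMid f e i) = e := by
  obtain ⟨-, -, h0, h1, hl, hr, hm, hE⟩ := packing_spec hf hc he hi
  have hne : packHi f e i - packLo f e i ≠ 0 := by linarith
  have hmem : packMid f e i ∈ Icc (packLo f e i) (packHi f e i) := ⟨hl.le, hr.le⟩
  rw [bump, indicator_of_mem hmem, sec]
  have e1 : (packHi f e i - packMid f e i) / (packHi f e i - packLo f e i) = 1 / 2 := by
    rw [hm]; field_simp; ring
  have e2 : (packMid f e i - packLo f e i) / (packHi f e i - packLo f e i) = 1 / 2 := by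
    rw [hm]; field_simp; ring
  rw [e1, e2]
  linarith

lemma continuousOn_bump (hf : ConvexOn ℝ (Icc 0 1) f) (hc : ContinuousOn f (Icc 0 1))
    (he : 0 < e) {i : ℕ} (hi : i < nPack f e) : ContinuousOn (bump f e i) (Icc 0 1) := by
  obtain ⟨-, -, h0, h1, hl, hr, -⟩ := packing_spec hf hc he hi
  -- clamping to the interval does not change the bump, which vanishes at the two endpoints
  have hclamp : ∀ x, bump f e i x =
      (fun x => sec f (packLo f e i) (packHi f e i) x - f x)
        (max (packLo f e i) (min (packHi f e i) x)) := by
    intro x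
    rcases le_total x (packLo f e i) with h | h
    · rw [bump_eq_zero hf hc he hi (fun hx => by linarith [hx.1]), min_eq_right (by linarith),
        max_eq_left h]
      simp [sec_left (hl.trans hr)]
    · rcases le_total (packHi f e i) x with h' | h'
      · rw [bump_eq_zero hf hc he hi (fun hx => by linarith [hx.2]), min_eq_left h',
          max_eq_right (by linarith)]
        simp [sec_right (hl.trans hr)]
      · rw [min_eq_right h', max_eq_right h, bump,
          indicator_of_mem (show x ∈ Icc (packLo f e i) (packHi f e i) from ⟨h, h'⟩)]
  have hcont : Continuous fun x => max (packLo f e i) (min (packHi f e i) x) := by fun_prop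
  have hsec : Continuous (sec f (packLo f e i) (packHi f e i)) := by
    unfold sec; fun_prop
  refine ContinuousOn.congr (f := fun x => (fun x => sec f (packLo f e i) (packHi f e i) x - f x)
        (max (packLo f e i) (min (packHi f e i) x))) ?_ fun x _ => hclamp x
  refine ContinuousOn.comp (t := Icc 0 1) (hsec.continuousOn.sub hc) hcont.continuousOn ?_
  intro x _
  exact ⟨h0.trans (le_max_left _ _), max_le (by linarith) ((min_le_left _ _).trans h1)⟩

lemma continuousOn_localAlt (hf : ConvexOn ℝ (Icc 0 1) f) (hc : ContinuousOn f (Icc 0 1))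
    (he : 0 < e) (b : Fin (nPack f e) → Bool) : ContinuousOn (localAlt f e b) (Icc 0 1) := by
  have : localAlt f e b = fun x => f x + ∑ i, if b i then bump f e i x else 0 := rfl
  rw [this]
  refine hc.add (continuousOn_finsetSum _ fun i _ => ?_)
  by_cases h : b i
  · simpa [h] using continuousOn_bump hf hc he i.2
  · simpa [h] using continuousOn_const

lemma packInt_disjoint (hf : ConvexOn ℝ (Icc 0 1) f) (hc : ContinuousOn f (Icc 0 1))
    (he : 0 < e) : Pairwise (Function.onFun Disjoint fun i : Fin (nPack f e) => packInt f e i) := by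
  intro i j hij
  wlog h : i < j generalizing i j
  · exact (this hij.symm (lt_of_le_of_ne (not_lt.1 h) hij.symm)).symm
  rw [Function.onFun, Set.disjoint_left]
  intro x hx hx'
  have := packing_separated hf hc he (i := i) (j := j) h j.2
  linarith [hx.2, hx'.1]

lemma localAlt_packMid (hf : ConvexOn ℝ (Icc 0 1) f) (hc : ContinuousOn f (Icc 0 1))
    (he : 0 < e) (b : Fin (nPack f e) → Bool) (i : Fin (nPack f e)) :
    localAlt f e b (packMid f e i) = f (packMid f e i) + if b i then e else 0 := by
  rw [localAlt_apply, Finset.sum_eq_single i]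
  · rw [bump_packMid hf hc he i.2]
  · intro j _ hji
    have hmem : packMid f e i ∈ packInt f e i := by
      obtain ⟨-, -, h0, h1, hl, hr, -⟩ := packing_spec hf hc he i.2
      exact ⟨hl, hr⟩
    rw [bump_eq_zero hf hc he j.2 fun hx =>
      Set.disjoint_left.1 (packInt_disjoint hf hc he hji) hx hmem]
    simp
  · simp

/-- Negation of the `i`-th bit. -/
def flipBit {n : ℕ} (b : Fin n → Bool) (i : Fin n) : Fin n → Bool := Function.update b i (!b i)

lemma flipBit_same {n : ℕ} (b : Fin n → Bool) (i : Fin n) : flipBit b i i = !b i := by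
  simp [flipBit]

lemma flipBit_flipBit {n : ℕ} (b : Fin n → Bool) (i : Fin n) : flipBit (flipBit b i) i = b := by
  simp [flipBit]

lemma localAlt_flipBit_sub (b : Fin (nPack f e) → Bool) (i : Fin (nPack f e)) (x : ℝ) :
    |localAlt f e (flipBit b i) x - localAlt f e b x| = |bump f e i x| := by
  have : localAlt f e (flipBit b i) x - localAlt f e b x
      = (if flipBit b i i then bump f e i x else 0) - if b i then bump f e i x else 0 := by
    rw [localAlt_apply, localAlt_apply, add_sub_add_left_eq_sub, ← Finset.sum_sub_distrib,
      Finset.sum_eq_single i]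
    · intro j _ hji
      rw [flipBit, Function.update_of_ne hji, sub_self]
    · simp
  rw [this, flipBit_same]
  cases b i <;> simp

lemma localAlt_flipBit_eq (hf : ConvexOn ℝ (Icc 0 1) f) (hc : ContinuousOn f (Icc 0 1))
    (he : 0 < e) (b : Fin (nPack f e) → Bool) (i : Fin (nPack f e)) {x : ℝ}
    (hx : x ∉ packInt f e i) : localAlt f e (flipBit b i) x = localAlt f e b x := by
  have := localAlt_flipBit_sub b i x
  rwa [bump_eq_zero hf hc he i.2 hx, abs_zero, abs_eq_zero, sub_eq_zero] at this

lemma abs_localAlt_flipBit_sub_le (hf : ConvexOn ℝ (Icc 0 1) f) (hc : ContinuousOn f (Icc 0 1))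
    (he : 0 < e) (b : Fin (nPack f e) → Bool) (i : Fin (nPack f e)) (x : ℝ) :
    |localAlt f e (flipBit b i) x - localAlt f e b x| ≤ 2 * e := by
  obtain ⟨h0, h1⟩ := bump_nonneg_le hf hc he i.2 x
  rwa [localAlt_flipBit_sub, abs_of_nonneg h0]

/-- Two distinct alternatives differ by `e` at the midpoint of some packing interval. -/
lemma exists_localAlt_sub_eq (hf : ConvexOn ℝ (Icc 0 1) f) (hc : ContinuousOn f (Icc 0 1))
    (he : 0 < e) {b b' : Fin (nPack f e) → Bool} (hb : b ≠ b') :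
    ∃ z ∈ Icc (0 : ℝ) 1, |localAlt f e b z - localAlt f e b' z| = e := by
  obtain ⟨i, hi⟩ := Function.ne_iff.1 hb
  obtain ⟨-, -, h0, h1, hl, hr, -⟩ := packing_spec hf hc he i.2
  refine ⟨packMid f e i, ⟨by linarith, by linarith⟩, ?_⟩
  rw [localAlt_packMid hf hc he, localAlt_packMid hf hc he]
  cases hbi : b i <;> cases hbi' : b' i <;> simp_all [abs_of_pos he]

lemma localAlt_injective (hf : ConvexOn ℝ (Icc 0 1) f) (hc : ContinuousOn f (Icc 0 1))
    (he : 0 < e) : Function.Injective (localAlt f e) := by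
  intro b b' h
  by_contra hb
  obtain ⟨z, -, hz⟩ := exists_localAlt_sub_eq hf hc he hb
  rw [h, sub_self, abs_zero] at hz
  exact he.ne hz

lemma localAlt_false : localAlt f e (fun _ => false) = f := by
  ext x
  simp [localAlt_apply]

lemma mem_altClass (b : Fin (nPack f e) → Bool) : localAlt f e b ∈ altClass f e := by
  classical
  simp [altClass]

lemma sum_altClass (hf : ConvexOn ℝ (Icc 0 1) f) (hc : ContinuousOn f (Icc 0 1))
    (he : 0 < e) (F : (ℝ → ℝ) → ℝ≥0∞) :
    ∑ g ∈ altClass f e, F g = ∑ b, F (localAlt f e b) := by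
  classical
  rw [altClass, Finset.sum_image ((localAlt_injective hf hc he).injOn)]

lemma card_altClass (hf : ConvexOn ℝ (Icc 0 1) f) (hc : ContinuousOn f (Icc 0 1))
    (he : 0 < e) : (altClass f e).card = 2 ^ nPack f e := by
  classical
  rw [altClass, Finset.card_image_of_injective _ (localAlt_injective hf hc he)]
  simp

end Alternatives

/-! ### Runs of an active algorithm -/

namespace ActiveAlgorithm

variable {U : Type*} [MeasurableSpace U] (alg : ActiveAlgorithm U) (g g' h : ℝ → ℝ)

/-- All that the algorithm knows after `t` measurements of `g`: the seed and the history. -/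
def state (t : ℕ) (p : U × (ℕ → ℝ)) : U × (Fin t → ℝ × ℝ) := (p.1, alg.history g p t)

/-- The design point of round `t` when the unknown function is `g`. -/
def query (t : ℕ) (p : U × (ℕ → ℝ)) : ℝ := alg.design t (alg.state g t p)

lemma query_mem (t : ℕ) (p : U × (ℕ → ℝ)) : alg.query g t p ∈ Icc (0 : ℝ) 1 :=
  alg.design_mem _ _

lemma history_succ (p : U × (ℕ → ℝ)) (t : ℕ) : alg.history g p (t + 1) =
    Fin.snoc (α := fun _ => ℝ × ℝ) (alg.history g p t)
      (alg.query g t p, g (alg.query g t p) + p.2 t) := rfl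

/-- Two runs that receive the same answers have the same history. -/
lemma state_congr {g g' : ℝ → ℝ} {p p' : U × (ℕ → ℝ)} (hu : p.1 = p'.1) {t : ℕ}
    (h : ∀ s < t, g (alg.query g s p) + p.2 s = g' (alg.query g s p) + p'.2 s) :
    alg.state g t p = alg.state g' t p' := by
  induction t with
  | zero => exact Prod.ext hu (funext fun i => i.elim0)
  | succ t ih =>
    have h1 := ih fun s hs => h s (by omega)
    refine Prod.ext hu ?_
    have hq : alg.query g t p = alg.query g' t p' := by rw [query, query, h1]
    have hh : alg.history g p t = alg.history g' p' t := congrArg Prod.snd h1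
    change alg.history g p (t + 1) = alg.history g' p' (t + 1)
    rw [history_succ, history_succ, hh, h t (by omega), hq]

/-- The state after `t` measurements does not depend on the noise of the rounds from `t` on. -/
lemma state_update {s t : ℕ} (hts : t ≤ s) (u : U) (w : ℕ → ℝ) (x : ℝ) :
    alg.state g t (u, Function.update w s x) = alg.state g t (u, w) := by
  refine alg.state_congr (p := (u, Function.update w s x)) (p' := (u, w)) rfl fun r hr => ?_
  simp only [Function.update_of_ne (show r ≠ s by omega)]

/-- Only the values of `k` on `[0, 1]` matter, so it may be replaced by a continuous extension. -/
lemma measurable_comp_query_of_measurable_state {g : ℝ → ℝ} {t : ℕ}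
    (hs : Measurable (alg.state g t)) {k : ℝ → ℝ} (hk : ContinuousOn k (Icc 0 1)) :
    Measurable fun p => k (alg.query g t p) := by
  have hext : Continuous (IccExtend zero_le_one ((Icc (0 : ℝ) 1).domRestrict k)) :=
    (continuousOn_iff_continuous_domRestrict.1 hk).Icc_extend'
  have : (fun p => k (alg.query g t p)) =
      fun p => IccExtend zero_le_one ((Icc (0 : ℝ) 1).domRestrict k) (alg.query g t p) := by
    ext p
    rw [IccExtend_of_mem _ _ (alg.query_mem g t p)]
    rfl
  rw [this]
  exact hext.measurable.comp ((alg.measurable_design t).comp hs)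

lemma measurable_state {g : ℝ → ℝ} (hg : ContinuousOn g (Icc 0 1)) (t : ℕ) :
    Measurable (alg.state g t) := by
  induction t with
  | zero => exact measurable_fst.prodMk (measurable_pi_iff.2 fun i => i.elim0)
  | succ t ih =>
    refine measurable_fst.prodMk (measurable_pi_iff.2 fun i => ?_)
    have hq : Measurable (alg.query g t) := (alg.measurable_design t).comp ih
    refine Fin.lastCases ?_ (fun j => ?_) i
    · simp only [history_succ, Fin.snoc_last]
      exact hq.prodMk ((alg.measurable_comp_query_of_measurable_state ih hg).add
        ((measurable_pi_apply t).comp measurable_snd))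
    · simp only [history_succ, Fin.snoc_castSucc]
      exact (measurable_pi_apply j).comp (measurable_snd.comp ih)

lemma measurable_query {g : ℝ → ℝ} (hg : ContinuousOn g (Icc 0 1)) (t : ℕ) :
    Measurable (alg.query g t) :=
  (alg.measurable_design t).comp (alg.measurable_state hg t)

lemma measurable_comp_query {g k : ℝ → ℝ} (hg : ContinuousOn g (Icc 0 1))
    (hk : ContinuousOn k (Icc 0 1)) (t : ℕ) : Measurable fun p => k (alg.query g t p) :=
  alg.measurable_comp_query_of_measurable_state (alg.measurable_state hg t) hk

/-- The event that more than `t` measurements are taken. -/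
def running (t : ℕ) : Set (U × (ℕ → ℝ)) := {p | ∀ s ≤ t, alg.state g s p ∉ alg.halt s}

/-- The event that exactly `t` measurements are taken and that the function then returned is at
distance less than `r` from `h`. -/
def stopNear (r : ℝ≥0∞) (t : ℕ) : Set (U × (ℕ → ℝ)) :=
  {p | alg.tau g p = t ∧ supDist (alg.estimate t (alg.state g t p)) h < r}

lemma lt_tau_iff {p : U × (ℕ → ℝ)} {t : ℕ} : (t : ℕ∞) < alg.tau g p ↔ p ∈ alg.running g t := by
  constructor
  · intro hlt s hs hmem
    have : alg.tau g p ≤ s := iInf₂_le s hmem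
    exact absurd (hlt.trans_le this) (not_lt.2 (by exact_mod_cast hs))
  · intro hrun
    have : ((t + 1 : ℕ) : ℕ∞) ≤ alg.tau g p := by
      refine le_iInf₂ fun s hs => ?_
      by_contra hcon
      have hst : s < t + 1 := by
        rw [not_le] at hcon; exact_mod_cast hcon
      exact hrun s (by omega) hs
    exact lt_of_lt_of_le (by exact_mod_cast Nat.lt_succ_self t) this

lemma tau_eq_iff {p : U × (ℕ → ℝ)} {t : ℕ} : alg.tau g p = t ↔
    alg.state g t p ∈ alg.halt t ∧ ∀ s < t, alg.state g s p ∉ alg.halt s := by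
  constructor
  · intro htau
    have h2 : ∀ s < t, alg.state g s p ∉ alg.halt s := fun s hs =>
      (alg.lt_tau_iff g).1 (show (s : ℕ∞) < alg.tau g p by rw [htau]; exact_mod_cast hs) s le_rfl
    refine ⟨?_, h2⟩
    by_contra hcon
    have : (t : ℕ∞) < alg.tau g p := (alg.lt_tau_iff g).2 fun s hs => by
      rcases hs.lt_or_eq with h' | rfl
      · exact h2 s h'
      · exact hcon
    rw [htau] at this
    exact lt_irrefl _ this
  · rintro ⟨h1, h2⟩
    refine le_antisymm (iInf₂_le t h1) (le_iInf₂ fun s hs => ?_)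
    by_contra hcon
    have hst : s < t := by
      rw [not_le] at hcon; exact_mod_cast hcon
    exact h2 s hst hs

lemma measurableSet_running {g : ℝ → ℝ} (hg : ContinuousOn g (Icc 0 1)) (t : ℕ) :
    MeasurableSet (alg.running g t) := by
  have : alg.running g t = ⋂ s ∈ Finset.range (t + 1), (alg.state g s ⁻¹' alg.halt s)ᶜ := by
    ext p; simp [running]
  rw [this]
  exact Finset.measurableSet_biInter _ fun s _ =>
    ((alg.measurable_state hg s) (alg.measurableSet_halt s)).compl

lemma measurableSet_stopNear {g h : ℝ → ℝ} (hg : ContinuousOn g (Icc 0 1))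
    (hh : ContinuousOn h (Icc 0 1)) (r : ℝ≥0) (t : ℕ) :
    MeasurableSet (alg.stopNear g h r t) := by
  have : alg.stopNear g h r t = ((alg.state g t ⁻¹' alg.halt t) ∩
      ⋂ s ∈ Finset.range t, (alg.state g s ⁻¹' alg.halt s)ᶜ) ∩
      alg.state g t ⁻¹' {q | supDist (alg.estimate t q) h < r} := by
    ext p
    simp [stopNear, tau_eq_iff]
  rw [this]
  exact (((alg.measurable_state hg t) (alg.measurableSet_halt t)).inter
    (Finset.measurableSet_biInter _ fun s _ =>
      ((alg.measurable_state hg s) (alg.measurableSet_halt s)).compl)).inter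
    ((alg.measurable_state hg t) (alg.measurable_estimate t h hh r))

/-- If the answers of two runs agree in each of the rounds `s < T` in which the first is still
running, then the two runs have the same outcome, provided that they stop by time `T`. -/
lemma mem_stopNear_congr {g g' h : ℝ → ℝ} {p p' : U × (ℕ → ℝ)} {r : ℝ≥0∞} (hu : p.1 = p'.1)
    {T : ℕ}
    (hans : ∀ s < T, p ∈ alg.running g s →
      g (alg.query g s p) + p.2 s = g' (alg.query g s p) + p'.2 s)
    {t : ℕ} (ht : t ≤ T) : p ∈ alg.stopNear g h r t ↔ p' ∈ alg.stopNear g' h r t := by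
  have hstate : ∀ n ≤ t, (∀ s < n, alg.state g s p ∉ alg.halt s) →
      alg.state g n p = alg.state g' n p' := fun n hn hrun =>
    alg.state_congr hu fun s hs => hans s (by omega) fun q hq => hrun q (by omega)
  constructor
  · rintro ⟨h1, h2⟩
    rw [tau_eq_iff] at h1
    refine ⟨(alg.tau_eq_iff g').2 ⟨?_, fun s hs => ?_⟩, ?_⟩
    · rw [← hstate t le_rfl h1.2]; exact h1.1
    · rw [← hstate s hs.le fun q hq => h1.2 q (by omega)]; exact h1.2 s hs
    · rw [← hstate t le_rfl h1.2]; exact h2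
  · rintro ⟨h1, h2⟩
    rw [tau_eq_iff] at h1
    have hrun : ∀ s < t, alg.state g s p ∉ alg.halt s := by
      intro s
      induction s using Nat.strong_induction_on with
      | _ s ih =>
        intro hs
        rw [hstate s hs.le fun q hq => ih q hq (by omega)]
        exact h1.2 s hs
    refine ⟨(alg.tau_eq_iff g).2 ⟨?_, hrun⟩, ?_⟩
    · rw [hstate t le_rfl hrun]; exact h1.1
    · rw [hstate t le_rfl hrun]; exact h2

/-- The event that the algorithm stops when run on `g`, and returns a function at distance less
than `r` from `h`. -/
def returnsNear (r : ℝ≥0∞) : Set (U × (ℕ → ℝ)) := ⋃ t, alg.stopNear g h r t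

lemma measurableSet_returnsNear {g h : ℝ → ℝ} (hg : ContinuousOn g (Icc 0 1))
    (hh : ContinuousOn h (Icc 0 1)) (r : ℝ≥0) : MeasurableSet (alg.returnsNear g h r) :=
  MeasurableSet.iUnion fun t => alg.measurableSet_stopNear hg hh r t

lemma le_supDist_add_supDist (k g h : ℝ → ℝ) {z : ℝ} (hz : z ∈ Icc (0 : ℝ) 1) :
    ENNReal.ofReal |g z - h z| ≤ supDist k g + supDist k h := by
  have h1 : edist (k z) (g z) ≤ supDist k g := le_iSup₂_of_le z hz le_rfl
  have h2 : edist (k z) (h z) ≤ supDist k h := le_iSup₂_of_le z hz le_rfl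
  rw [← Real.dist_eq, ← edist_dist]
  exact (edist_triangle_left _ _ (k z)).trans (add_le_add h1 h2)

/-- No function is close to each of two functions that are far apart. -/
lemma disjoint_returnsNear {g h h' : ℝ → ℝ} {ε z : ℝ} (hε : 0 < ε) (hz : z ∈ Icc (0 : ℝ) 1)
    (hzh : |h z - h' z| = 2 * ε) : Disjoint (alg.returnsNear g h (ENNReal.ofReal ε))
      (alg.returnsNear g h' (ENNReal.ofReal ε)) := by
  refine Set.disjoint_left.2 fun p hp hp' => ?_
  simp only [returnsNear, mem_iUnion] at hp hp'
  obtain ⟨s, hs1, hs2⟩ := hp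
  obtain ⟨t, ht1, ht2⟩ := hp'
  have hst : s = t := by exact_mod_cast hs1.symm.trans ht1
  subst hst
  have := (le_supDist_add_supDist _ h h' hz).trans_lt (ENNReal.add_lt_add hs2 ht2)
  rw [hzh, ← ENNReal.ofReal_add hε.le hε.le, two_mul] at this
  exact lt_irrefl _ this

variable (ρ : Measure U) (σ : ℝ≥0)

lemma correct_iff {ε δ : ℝ} : alg.Correct ρ σ ε δ g ↔
    ENNReal.ofReal (1 - δ) ≤ noiseLaw ρ σ (alg.returnsNear g g (ENNReal.ofReal ε)) := by
  have : alg.returnsNear g g (ENNReal.ofReal ε) = {p | ∃ t : ℕ, alg.tau g p = t ∧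
      supDist (alg.estimate t (p.1, alg.history g p t)) g < ENNReal.ofReal ε} := by
    ext p; simp [returnsNear, stopNear, state]
  rw [this]; rfl

/-- The expected number of measurements taken at points of `D`. -/
def expVisits (D : Set ℝ) : ℝ≥0∞ :=
  ∑' t, noiseLaw ρ σ (alg.running g t ∩ {p | alg.query g t p ∈ D})

lemma tsum_running_le_expTau {g : ℝ → ℝ} (hg : ContinuousOn g (Icc 0 1)) :
    ∑' t, noiseLaw ρ σ (alg.running g t) ≤ alg.expTau ρ σ g := by
  have h1 : ∀ t, noiseLaw ρ σ (alg.running g t) =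
      ∫⁻ p, (alg.running g t).indicator 1 p ∂(noiseLaw ρ σ) := fun t =>
    (lintegral_indicator_one (alg.measurableSet_running hg t)).symm
  simp_rw [h1]
  rw [← lintegral_tsum fun t =>
    (measurable_one.indicator (alg.measurableSet_running hg t)).aemeasurable]
  refine lintegral_mono fun p => ENNReal.tsum_le_of_sum_range_le fun n => ?_
  classical
  simp_rw [indicator_apply, ← alg.lt_tau_iff, Pi.one_apply]
  rw [← Finset.sum_filter, Finset.sum_const, nsmul_eq_mul, mul_one]
  cases htau : alg.tau g p with
  | top => simp
  | coe k =>
    have : (Finset.range n).filter (fun t : ℕ => (t : ℕ∞) < k) ⊆ Finset.range k := by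
      intro t ht
      have := (Finset.mem_filter.1 ht).2
      exact Finset.mem_range.2 (by exact_mod_cast this)
    have := Finset.card_le_card this
    rw [Finset.card_range] at this
    simpa using this

lemma measurableSet_visit {g : ℝ → ℝ} (hg : ContinuousOn g (Icc 0 1)) {D : Set ℝ}
    (hD : MeasurableSet D) (t : ℕ) :
    MeasurableSet (alg.running g t ∩ {p | alg.query g t p ∈ D}) :=
  (alg.measurableSet_running hg t).inter (alg.measurable_query hg t hD)

lemma sum_expVisits_le_expTau {g : ℝ → ℝ} (hg : ContinuousOn g (Icc 0 1)) {ι : Type*} [Fintype ι]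
    {D : ι → Set ℝ} (hD : ∀ i, MeasurableSet (D i)) (hdisj : Pairwise (Function.onFun Disjoint D)) :
    ∑ i, alg.expVisits g ρ σ (D i) ≤ alg.expTau ρ σ g := by
  refine le_trans ?_ (alg.tsum_running_le_expTau ρ σ hg)
  unfold expVisits
  rw [← tsum_fintype (L := .unconditional ι), ENNReal.tsum_comm]
  refine ENNReal.tsum_le_tsum fun t => ?_
  rw [← measure_iUnion]
  · exact measure_mono (iUnion_subset fun i => inter_subset_left)
  · intro i j hij
    exact Set.disjoint_left.2 fun p hp hp' => Set.disjoint_left.1 (hdisj hij) hp.2 hp'.2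
  · exact fun i => alg.measurableSet_visit hg (hD i) t

lemma expVisits_le_expTau {g : ℝ → ℝ} (hg : ContinuousOn g (Icc 0 1)) (D : Set ℝ) :
    alg.expVisits g ρ σ D ≤ alg.expTau ρ σ g :=
  (ENNReal.tsum_le_tsum fun _ => measure_mono inter_subset_left).trans
    (alg.tsum_running_le_expTau ρ σ hg)

instance [IsProbabilityMeasure ρ] : IsProbabilityMeasure (noiseLaw ρ σ) := by
  unfold noiseLaw; infer_instance

/-- A correct algorithm must visit the set `D` on which `g` differs from an alternative `g'` far
away: on the same noise, a run on `g` that does not visit `D` has the same outcome on `g'`. -/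
lemma one_third_le_expVisits [IsProbabilityMeasure ρ] {g g' : ℝ → ℝ}
    (hg' : ContinuousOn g' (Icc 0 1)) {D : Set ℝ}
    (hD : ∀ x ∈ Icc (0 : ℝ) 1, x ∉ D → g x = g' x) {ε δ : ℝ} (hε : 0 < ε) (hδ : δ < 1 / 3)
    {z : ℝ} (hz : z ∈ Icc (0 : ℝ) 1) (hzg : |g z - g' z| = 2 * ε)
    (hcg : alg.Correct ρ σ ε δ g) (hcg' : alg.Correct ρ σ ε δ g') :
    ENNReal.ofReal (1 / 3) ≤ alg.expVisits g ρ σ D := by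
  rw [correct_iff] at hcg hcg'
  set ν := noiseLaw ρ σ
  set A := alg.returnsNear g g (ENNReal.ofReal ε)
  set A' := alg.returnsNear g' g' (ENNReal.ofReal ε) with hA'
  set V := ⋃ t, alg.running g t ∩ {p | alg.query g t p ∈ D}
  have hV : ν V ≤ alg.expVisits g ρ σ D := measure_iUnion_le _
  refine le_trans ?_ hV
  have hsub : A ∩ A' ⊆ V := by
    rintro p ⟨hp, hp'⟩
    by_contra hpV
    have hans : ∀ s, p ∈ alg.running g s → g (alg.query g s p) + p.2 s
        = g' (alg.query g s p) + p.2 s := by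
      intro s hs
      rw [hD _ (alg.query_mem g s p) fun hmem => hpV (mem_iUnion.2 ⟨s, hs, hmem⟩)]
    obtain ⟨t, ht⟩ := mem_iUnion.1 hp
    have hp2 : p ∈ alg.returnsNear g' g (ENNReal.ofReal ε) := mem_iUnion.2 ⟨t,
      (alg.mem_stopNear_congr rfl (fun s (_ : s < t) hs => hans s hs) le_rfl).1 ht⟩
    exact Set.disjoint_left.1 (alg.disjoint_returnsNear hε hz hzg) hp2 hp'
  refine le_trans ?_ (measure_mono hsub)
  have hmA' : MeasurableSet A' := alg.measurableSet_returnsNear hg' hg' ε.toNNReal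
  have h1 : ν A ≤ ν (A ∩ A') + ν A'ᶜ := by
    refine (measure_mono fun p hp => ?_).trans (measure_union_le _ _)
    by_cases h : p ∈ A'
    · exact Or.inl ⟨hp, h⟩
    · exact Or.inr h
  have h2 : ν A'ᶜ ≤ ENNReal.ofReal δ := by
    rw [prob_compl_eq_one_sub hmA']
    refine (tsub_le_tsub_left hcg' 1).trans ?_
    rw [← ENNReal.ofReal_one, ← ENNReal.ofReal_sub _ (by linarith)]
    exact ENNReal.ofReal_le_ofReal (by linarith)
  have h3 : ENNReal.ofReal (1 - δ) ≤ ν (A ∩ A') + ENNReal.ofReal δ :=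
    hcg.trans (h1.trans (add_le_add le_rfl h2))
  rcases le_total 0 δ with h0 | h0
  · refine (ENNReal.ofReal_le_ofReal (by linarith : (1 : ℝ) / 3 ≤ 1 - δ - δ)).trans ?_
    rw [ENNReal.ofReal_sub _ h0]
    exact tsub_le_iff_right.2 h3
  · rw [ENNReal.ofReal_of_nonpos h0, add_zero] at h3
    exact (ENNReal.ofReal_le_ofReal (by linarith)).trans h3

end ActiveAlgorithm

/-! ### Change of measure by a predictable shift of the noise -/

lemma lintegral_gaussian_shift {v : ℝ≥0} (hv : v ≠ 0) (d : ℝ) {H : ℝ → ℝ≥0∞} (hH : Measurable H) :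
    ∫⁻ x, H (x + d) * ENNReal.ofReal (Real.exp (-((2 * x * d + d ^ 2) / (2 * v))))
      ∂(gaussianReal 0 v) = ∫⁻ x, H x ∂(gaussianReal 0 v) := by
  rw [gaussianReal_of_var_ne_zero 0 hv, lintegral_withDensity_eq_lintegral_mul _
    (measurable_gaussianPDF 0 v) (by fun_prop),
    lintegral_withDensity_eq_lintegral_mul _ (measurable_gaussianPDF 0 v) hH,
    ← lintegral_add_right_eq_self (fun x => (gaussianPDF 0 v * H) x) d]
  refine lintegral_congr fun x => ?_
  have hv' : (v : ℝ) ≠ 0 := by exact_mod_cast hv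
  have : gaussianPDF 0 v (x + d) = gaussianPDF 0 v x *
      ENNReal.ofReal (Real.exp (-((2 * x * d + d ^ 2) / (2 * v)))) := by
    rw [gaussianPDF, gaussianPDF, ← ENNReal.ofReal_mul (gaussianPDFReal_nonneg _ _ _),
      gaussianPDFReal, gaussianPDFReal, mul_assoc (_⁻¹), ← Real.exp_add]
    congr 3
    field_simp
    ring
  simp only [Pi.mul_apply]
  rw [this]
  ring

/-- Replacing one coordinate of an i.i.d. sequence by an independent copy does not change its
law. -/
lemma measurePreserving_update_infinitePi (γ : Measure ℝ) [IsProbabilityMeasure γ] (t : ℕ) :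
    MeasurePreserving (fun q : (ℕ → ℝ) × ℝ => Function.update q.1 t q.2)
      ((Measure.infinitePi fun _ : ℕ => γ).prod γ) (Measure.infinitePi fun _ : ℕ => γ) := by
  have hmeas : Measurable fun q : (ℕ → ℝ) × ℝ => Function.update q.1 t q.2 := by
    refine measurable_pi_iff.2 fun i => ?_
    by_cases h : i = t
    · subst h; simpa using measurable_snd
    · simp only [Function.update_of_ne h]
      fun_prop
  refine ⟨hmeas, Measure.eq_infinitePi _ fun s A hA => ?_⟩
  rw [Measure.map_apply hmeas (MeasurableSet.pi s.countable_toSet fun i _ => hA i)]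
  have hpre : (fun q : (ℕ → ℝ) × ℝ => Function.update q.1 t q.2) ⁻¹' (Set.pi s A) =
      (Set.pi (s.erase t : Finset ℕ) A) ×ˢ (if t ∈ s then A t else univ) := by
    ext q
    simp only [mem_preimage, Set.mem_pi, mem_prod, Finset.mem_coe, Finset.mem_erase]
    constructor
    · intro h
      refine ⟨fun i hi => by simpa [Function.update_of_ne hi.1] using h i hi.2, ?_⟩
      split_ifs with ht
      · simpa using h t ht
      · trivial
    · rintro ⟨h1, h2⟩ i hi
      by_cases hit : i = t
      · subst hit; simpa [hi] using h2
      · simpa [Function.update_of_ne hit] using h1 i ⟨hit, hi⟩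
  rw [hpre, Measure.prod_prod, Measure.infinitePi_pi _ fun i _ => hA i]
  by_cases ht : t ∈ s
  · rw [if_pos ht, Finset.prod_erase_mul s (fun i => γ (A i)) ht]
  · rw [if_neg ht, measure_univ, mul_one, Finset.erase_eq_of_notMem ht]

section Predictable

variable {U : Type*}

/-- A process that is predictable with respect to the noise: its value in round `t` does not
depend on the noise of the rounds from `t` on. -/
def Predictable (d : ℕ → U × (ℕ → ℝ) → ℝ) : Prop :=
  ∀ t s u w x, t ≤ s → d t (u, Function.update w s x) = d t (u, w)

/-- The noise of the first `T` rounds shifted by the process `d`. -/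
def noiseShift (d : ℕ → U × (ℕ → ℝ) → ℝ) (T : ℕ) (p : U × (ℕ → ℝ)) : U × (ℕ → ℝ) :=
  (p.1, fun t => if t < T then p.2 t + d t p else p.2 t)

/-- The log-likelihood ratio of the noise of the first `T` rounds before and after the shift
by `d`. -/
def logRatio (σ : ℝ≥0) (d : ℕ → U × (ℕ → ℝ) → ℝ) (T : ℕ) (p : U × (ℕ → ℝ)) : ℝ :=
  ∑ t ∈ Finset.range T, (2 * p.2 t * d t p + d t p ^ 2) / (2 * (σ ^ 2 : ℝ≥0))

variable (σ : ℝ≥0) {d : ℕ → U × (ℕ → ℝ) → ℝ}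

lemma logRatio_update (hp : Predictable d) (T : ℕ) (p : U × (ℕ → ℝ)) (x : ℝ) :
    logRatio σ d T (p.1, Function.update p.2 T x) = logRatio σ d T p := by
  refine Finset.sum_congr rfl fun t ht => ?_
  have ht' := Finset.mem_range.1 ht
  rw [hp t T p.1 p.2 x ht'.le]
  simp only [Function.update_of_ne ht'.ne]

lemma noiseShift_succ_update (hp : Predictable d) (T : ℕ) (p : U × (ℕ → ℝ)) (x : ℝ) :
    noiseShift d (T + 1) (p.1, Function.update p.2 T x) =
      ((noiseShift d T p).1, Function.update (noiseShift d T p).2 T (x + d T p)) := by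
  refine Prod.ext rfl (funext fun t => ?_)
  simp only [noiseShift]
  rcases lt_trichotomy t T with h | rfl | h
  · rw [if_pos (by omega), Function.update_of_ne h.ne, Function.update_of_ne h.ne, if_pos h,
      hp t T p.1 p.2 x h.le]
  · rw [if_pos (by omega), Function.update_self, Function.update_self, hp t t p.1 p.2 x le_rfl]
  · rw [if_neg (by omega), Function.update_of_ne h.ne', Function.update_of_ne h.ne',
      if_neg (by omega)]

end Predictable

section Shift

variable {U : Type*} [MeasurableSpace U] (ρ : Measure U) [IsProbabilityMeasure ρ] (σ : ℝ≥0)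

lemma measurePreserving_update_noiseLaw (t : ℕ) :
    MeasurePreserving (fun q : (U × (ℕ → ℝ)) × ℝ => (q.1.1, Function.update q.1.2 t q.2))
      ((noiseLaw ρ σ).prod (gaussianReal 0 (σ ^ 2))) (noiseLaw ρ σ) := by
  have h1 := measurePreserving_prodAssoc ρ
    (Measure.infinitePi fun _ : ℕ => gaussianReal 0 (σ ^ 2)) (gaussianReal 0 (σ ^ 2))
  have h2 := (MeasurePreserving.id ρ).prod
    (measurePreserving_update_infinitePi (gaussianReal 0 (σ ^ 2)) t)
  exact h2.comp h1

lemma lintegral_update_noiseLaw (t : ℕ) {F : U × (ℕ → ℝ) → ℝ≥0∞} (hF : Measurable F) :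
    ∫⁻ p, ∫⁻ x, F (p.1, Function.update p.2 t x) ∂(gaussianReal 0 (σ ^ 2)) ∂(noiseLaw ρ σ)
      = ∫⁻ p, F p ∂(noiseLaw ρ σ) := by
  have h := measurePreserving_update_noiseLaw ρ σ t
  rw [← h.lintegral_comp hF]
  exact (lintegral_prod _ (hF.comp h.measurable).aemeasurable).symm

variable {d : ℕ → U × (ℕ → ℝ) → ℝ}

lemma measurable_noiseShift (hd : ∀ t, Measurable (d t)) (T : ℕ) : Measurable (noiseShift d T) := by
  refine measurable_fst.prodMk (measurable_pi_iff.2 fun t => ?_)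
  have := hd t
  split_ifs <;> fun_prop

lemma measurable_logRatio (hd : ∀ t, Measurable (d t)) (T : ℕ) : Measurable (logRatio σ d T) := by
  unfold logRatio
  fun_prop

/-- Shifting the Gaussian noise of finitely many rounds by a predictable process and reweighting
by the likelihood ratio preserves the law of the noise. One round is integrated out at a time. -/
lemma lintegral_noiseShift (hσ : σ ≠ 0) (hd : ∀ t, Measurable (d t)) (hp : Predictable d) (T : ℕ)
    {G : U × (ℕ → ℝ) → ℝ≥0∞} (hG : Measurable G) :
    ∫⁻ p, G (noiseShift d T p) * ENNReal.ofReal (Real.exp (-logRatio σ d T p)) ∂(noiseLaw ρ σ)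
      = ∫⁻ p, G p ∂(noiseLaw ρ σ) := by
  induction T generalizing G with
  | zero => simp [noiseShift, logRatio]
  | succ T ih =>
    have hm1 := measurable_noiseShift hd T
    have hm2 := measurable_noiseShift hd (T + 1)
    have hl1 := measurable_logRatio σ hd T
    have hl2 := measurable_logRatio σ hd (T + 1)
    have hv : σ ^ 2 ≠ 0 := pow_ne_zero 2 hσ
    have hup := (measurePreserving_update_noiseLaw ρ σ T).measurable
    set H : U × (ℕ → ℝ) → ℝ≥0∞ :=
      fun p => ∫⁻ x, G (p.1, Function.update p.2 T x) ∂(gaussianReal 0 (σ ^ 2)) with hH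
    have hHm : Measurable H := (hG.comp hup).lintegral_prod_right'
    rw [← lintegral_update_noiseLaw ρ σ T (by fun_prop), ← lintegral_update_noiseLaw ρ σ T hG,
      ← ih hHm]
    refine lintegral_congr fun p => ?_
    have hu : Measurable fun x : ℝ => ((noiseShift d T p).1,
        Function.update (noiseShift d T p).2 T x) :=
      hup.comp (measurable_const.prodMk measurable_id : Measurable fun x : ℝ =>
        (noiseShift d T p, x))
    have hlr : ∀ x, logRatio σ d (T + 1) (p.1, Function.update p.2 T x) =
        logRatio σ d T p + (2 * x * d T p + d T p ^ 2) / (2 * (σ ^ 2 : ℝ≥0)) := by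
      intro x
      have := logRatio_update σ hp T p x
      rw [logRatio] at this ⊢
      rw [Finset.sum_range_succ, this, hp T T p.1 p.2 x le_rfl]
      simp
    simp_rw [noiseShift_succ_update hp, hlr, neg_add, Real.exp_add,
      ENNReal.ofReal_mul (Real.exp_pos _).le]
    rw [hH]
    simp only
    have hshift := lintegral_gaussian_shift hv (d T p) (hG.comp hu)
    simp only [Function.comp] at hshift
    rw [← hshift, ← lintegral_mul_const' _ _ ENNReal.ofReal_ne_top]
    refine lintegral_congr fun x => ?_
    ring

/-- The expected log-likelihood ratio of a bounded predictable shift: the linear terms have mean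
zero because the noise of a round is independent of the shift of that round. -/
lemma integral_logRatio (hd : ∀ t, Measurable (d t)) (hp : Predictable d) {C : ℝ}
    (hC : ∀ t p, |d t p| ≤ C) (T : ℕ) :
    Integrable (logRatio σ d T) (noiseLaw ρ σ) ∧
      ∫ p, logRatio σ d T p ∂(noiseLaw ρ σ)
        = (∑ t ∈ Finset.range T, ∫ p, d t p ^ 2 ∂(noiseLaw ρ σ)) / (2 * (σ ^ 2 : ℝ≥0)) := by
  have hw : ∀ t, MeasurePreserving (fun p : U × (ℕ → ℝ) => p.2 t) (noiseLaw ρ σ)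
      (gaussianReal 0 (σ ^ 2)) := fun t =>
    (measurePreserving_eval_infinitePi (fun _ : ℕ => gaussianReal 0 (σ ^ 2)) t).comp
      measurePreserving_snd
  have hid : Integrable (fun x : ℝ => x) (gaussianReal 0 (σ ^ 2)) :=
    (memLp_id_gaussianReal 1).integrable le_rfl
  have hwi : ∀ t, Integrable (fun p : U × (ℕ → ℝ) => p.2 t) (noiseLaw ρ σ) :=
    fun t => (hw t).integrable_comp_of_integrable hid
  have hwd : ∀ t, Integrable (fun p : U × (ℕ → ℝ) => p.2 t * d t p) (noiseLaw ρ σ) := fun t =>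
    (hwi t).mul_bdd (c := C) (hd t).aestronglyMeasurable (Filter.Eventually.of_forall (hC t))
  have hdd : ∀ t, Integrable (fun p => d t p ^ 2) (noiseLaw ρ σ) := fun t =>
    Integrable.of_bound ((hd t).pow_const 2).aestronglyMeasurable (C ^ 2)
      (Filter.Eventually.of_forall fun p => by
        rw [Real.norm_eq_abs, abs_pow]; exact pow_le_pow_left₀ (abs_nonneg _) (hC t p) 2)
  have hterm : ∀ t, Integrable (fun p : U × (ℕ → ℝ) =>
      (2 * p.2 t * d t p + d t p ^ 2) / (2 * (σ ^ 2 : ℝ≥0))) (noiseLaw ρ σ) := fun t =>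
    ((((hwd t).const_mul 2).congr (Filter.Eventually.of_forall fun p => by ring)).add
      (hdd t)).div_const _
  have hzero : ∀ t, ∫ p, p.2 t * d t p ∂(noiseLaw ρ σ) = 0 := by
    intro t
    have h := measurePreserving_update_noiseLaw ρ σ t
    have hm : Measurable fun p : U × (ℕ → ℝ) => p.2 t * d t p := by
      have := hd t
      fun_prop
    rw [← h.map_eq, integral_map h.measurable.aemeasurable hm.aestronglyMeasurable]
    have : ∀ q : (U × (ℕ → ℝ)) × ℝ, Function.update q.1.2 t q.2 t *
        d t (q.1.1, Function.update q.1.2 t q.2) = d t q.1 * q.2 := fun q => by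
      rw [Function.update_self, hp t t _ _ _ le_rfl, mul_comm]
    simp_rw [this]
    rw [integral_prod_mul (fun p => d t p) (fun x : ℝ => x), integral_id_gaussianReal, mul_zero]
  refine ⟨integrable_finsetSum _ fun t _ => hterm t, ?_⟩
  unfold logRatio
  rw [integral_finsetSum _ fun t _ => hterm t, Finset.sum_div]
  refine Finset.sum_congr rfl fun t _ => ?_
  rw [integral_div]
  congr 1
  have : ∀ p : U × (ℕ → ℝ), 2 * p.2 t * d t p + d t p ^ 2 = 2 * (p.2 t * d t p) + d t p ^ 2 :=
    fun p => by ring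
  simp_rw [this]
  rw [integral_add ((hwd t).const_mul 2) (hdd t), integral_const_mul, hzero t]
  ring

/-- The data-processing inequality for the relative entropy, in its variational form: for the
events `E` and `E'`, of which the first is the preimage of the second under a shift of the noise,
any `a`, `a'` give a lower bound on the expected log-likelihood ratio. -/
lemma le_integral_logRatio (hσ : σ ≠ 0) (hd : ∀ t, Measurable (d t)) (hp : Predictable d) {C : ℝ}
    (hC : ∀ t p, |d t p| ≤ C) (T : ℕ) {E E' : Set (U × (ℕ → ℝ))} (hE : MeasurableSet E)
    (hE' : MeasurableSet E') (hEE' : ∀ p, p ∈ E ↔ noiseShift d T p ∈ E') (a a' : ℝ) :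
    a * (noiseLaw ρ σ).real E + a' * (1 - (noiseLaw ρ σ).real E) + 1
        - Real.exp a * (noiseLaw ρ σ).real E' - Real.exp a' * (1 - (noiseLaw ρ σ).real E')
      ≤ ∫ p, logRatio σ d T p ∂(noiseLaw ρ σ) := by
  set ν := noiseLaw ρ σ with hν
  obtain ⟨hZ, -⟩ := integral_logRatio ρ σ hd hp hC T
  set Z := logRatio σ d T with hZdef
  have hZm : Measurable Z := measurable_logRatio σ hd T
  have hX : Integrable (fun p => Real.exp (-Z p)) ν := by
    refine ⟨(by fun_prop : Measurable fun p => Real.exp (-Z p)).aestronglyMeasurable, ?_⟩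
    rw [hasFiniteIntegral_iff_ofReal (Filter.Eventually.of_forall fun p => (Real.exp_pos _).le)]
    have := lintegral_noiseShift ρ σ hσ hd hp T (G := fun _ => 1) measurable_const
    simp only [one_mul, lintegral_const, measure_univ, mul_one] at this
    rw [this]
    exact ENNReal.one_lt_top
  have hset : ∀ (A A' : Set (U × (ℕ → ℝ))), MeasurableSet A → MeasurableSet A' →
      (∀ p, p ∈ A ↔ noiseShift d T p ∈ A') → ∫ p in A, Real.exp (-Z p) ∂ν = ν.real A' := by
    intro A A' hA hA' hAA'
    rw [integral_eq_lintegral_of_nonneg_ae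
      (Filter.Eventually.of_forall fun p => (Real.exp_pos _).le) hX.1.restrict, measureReal_def,
      ← lintegral_indicator_one hA', ← lintegral_noiseShift ρ σ hσ hd hp T
        (measurable_one.indicator hA'), ← lintegral_indicator hA]
    congr 1
    refine lintegral_congr fun p => ?_
    by_cases h : p ∈ A
    · rw [indicator_of_mem h, indicator_of_mem ((hAA' p).1 h)]; simp [hZdef]
    · rw [indicator_of_notMem h, indicator_of_notMem fun h' => h ((hAA' p).2 h')]; simp
  have hbound : ∀ (A A' : Set (U × (ℕ → ℝ))), MeasurableSet A → MeasurableSet A' →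
      (∀ p, p ∈ A ↔ noiseShift d T p ∈ A') → ∀ c : ℝ,
      (1 + c) * ν.real A - ∫ p in A, Z p ∂ν ≤ Real.exp c * ν.real A' := by
    intro A A' hA hA' hAA' c
    rw [← hset A A' hA hA' hAA', ← integral_const_mul]
    have h1 : ∫ p in A, (1 + c - Z p) ∂ν = (1 + c) * ν.real A - ∫ p in A, Z p ∂ν := by
      rw [integral_sub (integrable_const _) hZ.restrict]
      simp [mul_comm, hν]
    rw [← h1]
    refine setIntegral_mono ((integrable_const _).sub hZ.restrict) (hX.restrict.const_mul _)
      fun p => ?_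
    simp only
    rw [← Real.exp_add]
    have := Real.add_one_le_exp (c + -Z p)
    linarith
  -- the bound on `E` is used with the parameter `a`, the one on its complement with `a'`
  have b1 := hbound E E' hE hE' hEE' a
  have b2 := hbound Eᶜ E'ᶜ hE.compl hE'.compl (fun p => not_congr (hEE' p)) a'
  rw [probReal_compl_eq_one_sub hE, probReal_compl_eq_one_sub hE'] at b2
  have b3 := integral_add_compl hE hZ
  linarith

end Shift

namespace ActiveAlgorithm

variable {U : Type*} [MeasurableSpace U] (alg : ActiveAlgorithm U) (ρ : Measure U)
  [IsProbabilityMeasure ρ] (σ : ℝ≥0)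

/-- The information bound: if `g` and `g'` differ by at most `C`, and only on `D`, then the
relative entropy between the outcomes of the runs on `g` and on `g'` is at most
`C ^ 2 / (2 * σ ^ 2)` times the expected number of visits to `D`. Shifting the noise by `g - g'` at
the design point, as long as the run on `g` continues, turns it into a run on `g'`. -/
lemma entropy_le_expVisits (hσ : σ ≠ 0) {g g' h : ℝ → ℝ} (hg : ContinuousOn g (Icc 0 1))
    (hg' : ContinuousOn g' (Icc 0 1)) (hh : ContinuousOn h (Icc 0 1)) {D : Set ℝ}
    (hDm : MeasurableSet D) (hD : ∀ x ∈ Icc (0 : ℝ) 1, x ∉ D → g x = g' x) {C : ℝ}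
    (hC : ∀ x ∈ Icc (0 : ℝ) 1, |g x - g' x| ≤ C) (hfin : alg.expVisits g ρ σ D ≠ ∞)
    (r : ℝ≥0) (a a' : ℝ) :
    a * (noiseLaw ρ σ).real (alg.returnsNear g h r)
        + a' * (1 - (noiseLaw ρ σ).real (alg.returnsNear g h r)) + 1
        - Real.exp a * (noiseLaw ρ σ).real (alg.returnsNear g' h r)
        - Real.exp a' * (1 - (noiseLaw ρ σ).real (alg.returnsNear g' h r))
      ≤ C ^ 2 / (2 * (σ : ℝ) ^ 2) * (alg.expVisits g ρ σ D).toReal := by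
  classical
  set ν := noiseLaw ρ σ with hν
  set d : ℕ → U × (ℕ → ℝ) → ℝ := fun t =>
    (alg.running g t).indicator fun p => g (alg.query g t p) - g' (alg.query g t p) with hdef
  have hd : ∀ t, Measurable (d t) := fun t =>
    ((alg.measurable_comp_query hg hg t).sub (alg.measurable_comp_query hg hg' t)).indicator
      (alg.measurableSet_running hg t)
  have hp : Predictable d := by
    intro t s u w x hts
    have hq : alg.query g t (u, Function.update w s x) = alg.query g t (u, w) := by
      rw [query, query, alg.state_update g hts]
    have hr : (u, Function.update w s x) ∈ alg.running g t ↔ (u, w) ∈ alg.running g t :=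
      forall₂_congr fun q hq => by rw [alg.state_update g (hq.trans hts)]
    simp only [hdef, indicator_apply, hr, hq]
  have hC0 : 0 ≤ C := (abs_nonneg _).trans (hC 0 ⟨le_rfl, zero_le_one⟩)
  have hdC : ∀ t p, |d t p| ≤ C := by
    intro t p
    simp only [hdef, indicator_apply]
    split_ifs
    · exact hC _ (alg.query_mem g t p)
    · simpa using hC0
  have hsq : ∀ t, ∫ p, d t p ^ 2 ∂ν ≤
      C ^ 2 * (ν (alg.running g t ∩ {p | alg.query g t p ∈ D})).toReal := by
    intro t
    have hm := alg.measurableSet_visit hg hDm t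
    rw [← measureReal_def, ← integral_indicator_one hm, ← integral_const_mul]
    refine integral_mono_of_nonneg (Filter.Eventually.of_forall fun p => sq_nonneg _)
      (((integrable_const (1 : ℝ)).indicator hm).const_mul _)
      (Filter.Eventually.of_forall fun p => ?_)
    simp only
    by_cases hv : p ∈ alg.running g t ∩ {p | alg.query g t p ∈ D}
    · rw [indicator_of_mem hv, Pi.one_apply, mul_one, ← sq_abs]
      exact pow_le_pow_left₀ (abs_nonneg _) (hdC t p) 2
    · rw [indicator_of_notMem hv, mul_zero]
      have : d t p = 0 := by
        simp only [hdef, indicator_apply]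
        split_ifs with hrun
        · exact sub_eq_zero.2 (hD _ (alg.query_mem g t p) fun hmem => hv ⟨hrun, hmem⟩)
        · rfl
      rw [this]; simp
  have hT : ∀ T : ℕ, a * ν.real (accumulate (alg.stopNear g h r) T)
        + a' * (1 - ν.real (accumulate (alg.stopNear g h r) T)) + 1
        - Real.exp a * ν.real (accumulate (alg.stopNear g' h r) T)
        - Real.exp a' * (1 - ν.real (accumulate (alg.stopNear g' h r) T))
      ≤ C ^ 2 / (2 * (σ : ℝ) ^ 2) * (alg.expVisits g ρ σ D).toReal := by
    intro T
    have hmeas : ∀ k : ℝ → ℝ, ContinuousOn k (Icc 0 1) →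
        MeasurableSet (accumulate (alg.stopNear k h r) T) := fun k hk =>
      MeasurableSet.biUnion (to_countable _) fun t _ => alg.measurableSet_stopNear hk hh r t
    have hiff : ∀ p, p ∈ accumulate (alg.stopNear g h r) T ↔
        noiseShift d T p ∈ accumulate (alg.stopNear g' h r) T := by
      intro p
      simp only [mem_accumulate]
      refine exists_congr fun t => and_congr_right fun ht => ?_
      refine alg.mem_stopNear_congr (p := p) (p' := noiseShift d T p) rfl (T := T)
        (fun s hs hrun => ?_) ht
      simp only [noiseShift, if_pos hs, hdef, indicator_of_mem hrun]
      ring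
    refine (le_integral_logRatio ρ σ hσ hd hp hdC T (hmeas g hg) (hmeas g' hg') hiff a a').trans ?_
    rw [(integral_logRatio ρ σ hd hp hdC T).2, div_mul_eq_mul_div]
    push_cast
    refine div_le_div_of_nonneg_right ?_ (by positivity)
    refine (Finset.sum_le_sum fun t _ => hsq t).trans ?_
    rw [← Finset.mul_sum, ← ENNReal.toReal_sum fun t _ => measure_ne_top _ _]
    exact mul_le_mul_of_nonneg_left (ENNReal.toReal_mono hfin (ENNReal.sum_le_tsum _)) (sq_nonneg C)
  have hlim : ∀ k : ℝ → ℝ, Filter.Tendsto (fun T => ν.real (accumulate (alg.stopNear k h r) T))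
      Filter.atTop (nhds (ν.real (alg.returnsNear k h r))) := fun k =>
    (ENNReal.tendsto_toReal (measure_ne_top _ _)).comp tendsto_measure_iUnion_accumulate
  exact le_of_tendsto (((((hlim g).const_mul a).add (((hlim g).const_sub 1).const_mul a')).add_const
    1).sub ((hlim g').const_mul _) |>.sub (((hlim g').const_sub 1).const_mul _))
    (Filter.Eventually.of_forall hT)

end ActiveAlgorithm

/-! ### The lower bounds on the number of measurements -/

lemma log_inv_le {δ : ℝ} (h0 : 0 < δ) (h1 : δ < 1 / 3) :
    1 / 2 * Real.log (1 / δ) ≤ Real.log ((1 - δ) / δ) := by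
  have h : Real.log (1 / δ) ≤ Real.log (((1 - δ) / δ) ^ 2) := by
    refine Real.log_le_log (by positivity) ?_
    rw [div_pow, div_le_div_iff₀ h0 (by positivity)]
    nlinarith
  rw [Real.log_pow] at h
  push_cast at h
  linarith

lemma log_one_div_pos {δ : ℝ} (h0 : 0 < δ) (h1 : δ < 1 / 3) : 0 < Real.log (1 / δ) :=
  Real.log_pos (by rw [lt_div_iff₀ h0]; linarith)

/-- The variational bound evaluated for two events whose probabilities are separated by the
confidence level `δ`. The parameters `± log ((1 - δ) / δ)` are optimal for the probabilities `1 - δ`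
and `δ`. -/
lemma binary_entropy_bound {δ p η : ℝ} (h0 : 0 < δ) (h1 : δ < 1 / 3) (hp : 1 - δ ≤ p)
    (hη : η ≤ δ) : 1 / 6 * Real.log (1 / δ) ≤
      Real.log ((1 - δ) / δ) * p + -Real.log ((1 - δ) / δ) * (1 - p) + 1
        - Real.exp (Real.log ((1 - δ) / δ)) * η
        - Real.exp (-Real.log ((1 - δ) / δ)) * (1 - η) := by
  have hq : 0 < (1 - δ) / δ := div_pos (by linarith) h0
  have hlog := log_inv_le h0 h1
  have hpos := log_one_div_pos h0 h1
  rw [Real.exp_neg, Real.exp_log hq, inv_div]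
  set L := Real.log ((1 - δ) / δ)
  have e1 : (1 - δ) / δ * η + δ / (1 - δ) * (1 - η) ≤ 1 := by
    have hd : 0 < 1 - δ := by linarith
    have hk : δ / (1 - δ) ≤ (1 - δ) / δ := by
      rw [div_le_div_iff₀ hd h0]; nlinarith
    have e2 : (1 - δ) / δ * δ + δ / (1 - δ) * (1 - δ) = 1 := by field_simp; ring
    nlinarith [mul_nonneg (sub_nonneg.2 hk) (sub_nonneg.2 hη)]
  nlinarith [mul_nonneg (show 0 ≤ L by linarith) (show 0 ≤ p - (1 - δ) by linarith),
    mul_nonneg (show 0 ≤ L by linarith) (show 0 ≤ 1 / 3 - δ by linarith)]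

/-- The variational bound summed over `n ≥ 2` pairs of events, the second of which have total
probability at most `δ`, so that they have probability `δ / n` on average; the first parameter is
chosen accordingly. -/
lemma sum_entropy_bound {n : ℕ} (hn : 2 ≤ n) {δ : ℝ} (h0 : 0 < δ) (h1 : δ < 1 / 3)
    {p η : Fin n → ℝ} (hp : ∀ i, 1 - δ ≤ p i) (hη0 : ∀ i, 0 ≤ η i) (hη : ∑ i, η i ≤ δ) :
    n * (1 / 6 * Real.log (n / δ)) ≤ ∑ i,
      (Real.log (n * ((1 - δ) / δ)) * p i + -Real.log ((1 - δ) / δ) * (1 - p i) + 1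
        - Real.exp (Real.log (n * ((1 - δ) / δ))) * η i
        - Real.exp (-Real.log ((1 - δ) / δ)) * (1 - η i)) := by
  have hq : 0 < (1 - δ) / δ := div_pos (by linarith) h0
  have hn0 : (2 : ℝ) ≤ n := by exact_mod_cast hn
  have hnpos : (0 : ℝ) < n := by linarith
  have hd : 0 < 1 - δ := by linarith
  have hlog := log_inv_le h0 h1
  have hpos := log_one_div_pos h0 h1
  have hlog2 : 1 / 2 ≤ Real.log n := by
    have := Real.log_two_gt_d9
    have := Real.log_le_log (by norm_num) hn0
    linarith
  rw [Real.exp_neg, Real.exp_log hq, inv_div, Real.exp_log (by positivity),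
    Real.log_mul hnpos.ne' hq.ne', Real.log_div hnpos.ne' h0.ne']
  rw [Real.log_div one_ne_zero h0.ne', Real.log_one, zero_sub] at hlog hpos
  set L := Real.log ((1 - δ) / δ)
  set M := Real.log n
  have hterm : ∀ i, (M + L) * (1 - δ) - L * δ + 1 - δ / (1 - δ) - n * ((1 - δ) / δ) * η i ≤
      (M + L) * p i + -L * (1 - p i) + 1 - n * ((1 - δ) / δ) * η i
        - δ / (1 - δ) * (1 - η i) := by
    intro i
    have a1 : 0 ≤ δ / (1 - δ) * η i := mul_nonneg (by positivity) (hη0 i)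
    nlinarith [mul_nonneg (show 0 ≤ M + 2 * L by linarith) (sub_nonneg.2 (hp i))]
  refine le_trans ?_ (Finset.sum_le_sum fun i _ => hterm i)
  rw [Finset.sum_sub_distrib, ← Finset.mul_sum, Finset.sum_const, Finset.card_univ,
    Fintype.card_fin, nsmul_eq_mul]
  have a2 : n * ((1 - δ) / δ) * ∑ i, η i ≤ n * (1 - δ) := by
    calc n * ((1 - δ) / δ) * ∑ i, η i ≤ n * ((1 - δ) / δ) * δ :=
          mul_le_mul_of_nonneg_left hη (by positivity)
      _ = _ := by field_simp
  have a3 : δ / (1 - δ) ≤ δ + 1 / 6 := by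
    rw [div_le_iff₀ hd]; nlinarith
  have a4 : 1 / 6 * (M - Real.log δ) ≤
      (M + L) * (1 - δ) - L * δ + 1 - δ / (1 - δ) - (1 - δ) := by
    nlinarith [mul_nonneg (show 0 ≤ M by linarith) (show 0 ≤ 1 / 3 - δ by linarith),
      mul_nonneg (show 0 ≤ L by linarith) (show 0 ≤ 1 / 3 - δ by linarith)]
  nlinarith [mul_le_mul_of_nonneg_left a4 hnpos.le]

namespace ActiveAlgorithm

variable {U : Type*} [MeasurableSpace U] {alg : ActiveAlgorithm U} {ρ : Measure U}
  [IsProbabilityMeasure ρ] {σ : ℝ≥0} {ε δ : ℝ}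

lemma Correct.le_real {g : ℝ → ℝ} (h : alg.Correct ρ σ ε δ g) :
    1 - δ ≤ (noiseLaw ρ σ).real (alg.returnsNear g g (ENNReal.ofReal ε)) := by
  rw [correct_iff] at h
  exact (ENNReal.ofReal_le_iff_le_toReal (measure_ne_top _ _)).1 h

/-- Distinguishing two functions that are `2 * ε` apart at some point, at most `4 * ε` apart
everywhere, and equal outside `D` takes many measurements in `D`. The constant `1 / 24` is the
factor `1 / 6` of `binary_entropy_bound` times the ratio `1 / 4` of `2 * σ ^ 2 / (4 * ε) ^ 2` to
`σ ^ 2 / (2 * ε ^ 2)`. -/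
lemma two_point_bound {g g' : ℝ → ℝ} (hg : ContinuousOn g (Icc 0 1))
    (hg' : ContinuousOn g' (Icc 0 1)) {D : Set ℝ} (hDm : MeasurableSet D)
    (hD : ∀ x ∈ Icc (0 : ℝ) 1, x ∉ D → g x = g' x)
    (hC : ∀ x ∈ Icc (0 : ℝ) 1, |g x - g' x| ≤ 4 * ε) (hε : 0 < ε) (h0 : 0 < δ) (h1 : δ < 1 / 3)
    {z : ℝ} (hz : z ∈ Icc (0 : ℝ) 1) (hzg : |g z - g' z| = 2 * ε)
    (hcg : alg.Correct ρ σ ε δ g) (hcg' : alg.Correct ρ σ ε δ g') :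
    ENNReal.ofReal (1 / 24 * max 1 ((σ : ℝ) ^ 2 / (2 * ε ^ 2) * Real.log (1 / δ)))
      ≤ alg.expVisits g ρ σ D := by
  rcases le_total ((σ : ℝ) ^ 2 / (2 * ε ^ 2) * Real.log (1 / δ)) 1 with hm | hm
  · rw [max_eq_left hm]
    exact (ENNReal.ofReal_le_ofReal (by norm_num)).trans
      (alg.one_third_le_expVisits ρ σ hg' hD hε h1 hz hzg hcg hcg')
  · rw [max_eq_right hm]
    have hσ : σ ≠ 0 := by
      rintro rfl
      rw [NNReal.coe_zero, zero_pow two_ne_zero, zero_div, zero_mul] at hm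
      exact absurd hm (by norm_num)
    by_cases hfin : alg.expVisits g ρ σ D = ∞
    · rw [hfin]; exact le_top
    rw [ENNReal.ofReal_le_iff_le_toReal hfin]
    have hent := alg.entropy_le_expVisits ρ σ hσ hg hg' hg hDm hD hC hfin ε.toNNReal
      (Real.log ((1 - δ) / δ)) (-Real.log ((1 - δ) / δ))
    have hη : (noiseLaw ρ σ).real (alg.returnsNear g' g (ENNReal.ofReal ε)) ≤ δ := by
      have hdisj := alg.disjoint_returnsNear (g := g') hε hz hzg
      have := measureReal_union (μ := noiseLaw ρ σ) hdisj
        (alg.measurableSet_returnsNear hg' hg' ε.toNNReal)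
      have h3 : (noiseLaw ρ σ).real (alg.returnsNear g' g (ENNReal.ofReal ε) ∪
        alg.returnsNear g' g' (ENNReal.ofReal ε)) ≤ 1 := measureReal_le_one
      have := hcg'.le_real
      linarith
    have h2 := (binary_entropy_bound h0 h1 hcg.le_real hη).trans hent
    have hσ' : (0 : ℝ) < σ := by exact_mod_cast pos_iff_ne_zero.2 hσ
    have h4 := mul_le_mul_of_nonneg_left h2 (show 0 ≤ (σ : ℝ) ^ 2 / (8 * ε ^ 2) by positivity)
    have e1 : (σ : ℝ) ^ 2 / (8 * ε ^ 2) * ((4 * ε) ^ 2 / (2 * (σ : ℝ) ^ 2)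
        * (alg.expVisits g ρ σ D).toReal) = (alg.expVisits g ρ σ D).toReal := by
      field_simp; ring
    have e2 : (σ : ℝ) ^ 2 / (8 * ε ^ 2) * (1 / 6 * Real.log (1 / δ)) =
        1 / 24 * ((σ : ℝ) ^ 2 / (2 * ε ^ 2) * Real.log (1 / δ)) := by
      field_simp; ring
    rwa [e1, e2] at h4

end ActiveAlgorithm

section Average

variable {U : Type*} [MeasurableSpace U] {alg : ActiveAlgorithm U} {ρ : Measure U} {σ : ℝ≥0}
  {f : ℝ → ℝ} {ε : ℝ}

/-- Every flipped alternative is an alternative, so that summing over all alternatives and bits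
counts each visit once. -/
lemma sum_flipBit_expVisits_le (hf : ConvexOn ℝ (Icc 0 1) f) (hc : ContinuousOn f (Icc 0 1))
    (hε : 0 < ε) :
    ∑ b, ∑ i, alg.expVisits (localAlt f (2 * ε) (flipBit b i)) ρ σ (packInt f (2 * ε) i)
      ≤ ∑ b, alg.expTau ρ σ (localAlt f (2 * ε) b) := by
  have he : 0 < 2 * ε := by linarith
  have hre : ∀ i : Fin (nPack f (2 * ε)),
      ∑ b, alg.expVisits (localAlt f (2 * ε) (flipBit b i)) ρ σ (packInt f (2 * ε) i)
      = ∑ b, alg.expVisits (localAlt f (2 * ε) b) ρ σ (packInt f (2 * ε) i) := fun i =>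
    (Function.Involutive.bijective fun b => flipBit_flipBit b i).sum_comp
      fun b => alg.expVisits (localAlt f (2 * ε) b) ρ σ (packInt f (2 * ε) i)
  rw [Finset.sum_comm, Finset.sum_congr rfl fun i _ => hre i, Finset.sum_comm]
  exact Finset.sum_le_sum fun b _ => alg.sum_expVisits_le_expTau ρ σ
    (continuousOn_localAlt hf hc he b)
    (D := fun i : Fin (nPack f (2 * ε)) => packInt f (2 * ε) i) (fun i => measurableSet_Ioo)
    (packInt_disjoint hf hc he)

lemma le_average_altClass (hf : ConvexOn ℝ (Icc 0 1) f) (hc : ContinuousOn f (Icc 0 1))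
    (hε : 0 < ε) {X : ℝ≥0∞} (h : ∑ _b : Fin (nPack f (2 * ε)) → Bool, X
      ≤ ∑ b, alg.expTau ρ σ (localAlt f (2 * ε) b)) :
    X ≤ (∑ g ∈ altClass f (2 * ε), alg.expTau ρ σ g) / ((altClass f (2 * ε)).card : ℝ≥0∞) := by
  have he : 0 < 2 * ε := by linarith
  rw [sum_altClass hf hc he, card_altClass hf hc he,
    ENNReal.le_div_iff_mul_le (Or.inl (by simp)) (Or.inl (ENNReal.natCast_ne_top _))]
  rw [Finset.sum_const, nsmul_eq_mul, mul_comm] at h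
  simpa using h

end Average

section Main

variable {U : Type*} [MeasurableSpace U] {alg : ActiveAlgorithm U} {ρ : Measure U}
  [IsProbabilityMeasure ρ] {σ : ℝ≥0} {f : ℝ → ℝ} {ε δ : ℝ}

lemma exists_localAlt_flipBit_sub_eq (hf : ConvexOn ℝ (Icc 0 1) f) (hc : ContinuousOn f (Icc 0 1))
    (hε : 0 < ε) (b : Fin (nPack f (2 * ε)) → Bool) (i : Fin (nPack f (2 * ε))) :
    ∃ z ∈ Icc (0 : ℝ) 1,
      |localAlt f (2 * ε) b z - localAlt f (2 * ε) (flipBit b i) z| = 2 * ε := by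
  refine exists_localAlt_sub_eq hf hc (by linarith) fun h => ?_
  have := congrFun h i
  rw [flipBit_same] at this
  simp at this

/-- On each single alternative, every one of its neighbours must be ruled out. -/
lemma expTau_localAlt_ge (hf : ConvexOn ℝ (Icc 0 1) f) (hc : ContinuousOn f (Icc 0 1))
    (hε : 0 < ε) (h0 : 0 < δ) (h1 : δ < 1 / 3)
    (hcor : ∀ g ∈ altClass f (2 * ε), alg.Correct ρ σ ε δ g)
    (b : Fin (nPack f (2 * ε)) → Bool) :
    ENNReal.ofReal (1 / 24 * ((nPack f (2 * ε) : ℕ) *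
      max 1 ((σ : ℝ) ^ 2 / (2 * ε ^ 2) * Real.log (1 / δ))))
      ≤ alg.expTau ρ σ (localAlt f (2 * ε) b) := by
  have he : 0 < 2 * ε := by linarith
  have hcont := fun b => continuousOn_localAlt hf hc he b
  refine le_trans ?_ (alg.sum_expVisits_le_expTau ρ σ (hcont b)
    (D := fun i : Fin (nPack f (2 * ε)) => packInt f (2 * ε) i) (fun i => measurableSet_Ioo)
    (packInt_disjoint hf hc he))
  have hi : ∀ i : Fin (nPack f (2 * ε)),
      ENNReal.ofReal (1 / 24 * max 1 ((σ : ℝ) ^ 2 / (2 * ε ^ 2) * Real.log (1 / δ)))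
      ≤ alg.expVisits (localAlt f (2 * ε) b) ρ σ (packInt f (2 * ε) i) := by
    intro i
    obtain ⟨z, hz, hzg⟩ := exists_localAlt_flipBit_sub_eq hf hc hε b i
    refine ActiveAlgorithm.two_point_bound (hcont b) (hcont (flipBit b i)) measurableSet_Ioo
      (fun x _ hx => (localAlt_flipBit_eq hf hc he b i hx).symm) (fun x _ => ?_) hε h0 h1 hz hzg
      (hcor _ (mem_altClass b)) (hcor _ (mem_altClass _))
    rw [abs_sub_comm]
    exact (abs_localAlt_flipBit_sub_le hf hc he b i x).trans (by linarith)
  refine le_trans (le_of_eq ?_) (Finset.sum_le_sum fun i _ => hi i)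
  rw [Finset.sum_const, Finset.card_univ, Fintype.card_fin, nsmul_eq_mul, mul_left_comm,
    ENNReal.ofReal_mul (Nat.cast_nonneg _), ENNReal.ofReal_natCast]

/-- The visits to the `i`-th interval on the `i`-th neighbour of a fixed alternative, summed over
`i`: on the fixed alternative at most one of the neighbours is returned, so on average each of them
is returned with probability at most `δ / n`, which is the source of the factor `log (n / δ)`. -/
lemma sum_expVisits_flipBit_ge (hf : ConvexOn ℝ (Icc 0 1) f) (hc : ContinuousOn f (Icc 0 1))
    (hε : 0 < ε) (h0 : 0 < δ) (h1 : δ < 1 / 3) (hσ : σ ≠ 0) (hn : 2 ≤ nPack f (2 * ε))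
    (hcor : ∀ g ∈ altClass f (2 * ε), alg.Correct ρ σ ε δ g)
    (b : Fin (nPack f (2 * ε)) → Bool) :
    ENNReal.ofReal (1 / 24 * ((nPack f (2 * ε) : ℕ) *
      ((σ : ℝ) ^ 2 / (2 * ε ^ 2) * Real.log ((nPack f (2 * ε) : ℕ) / δ))))
      ≤ ∑ i, alg.expVisits (localAlt f (2 * ε) (flipBit b i)) ρ σ (packInt f (2 * ε) i) := by
  have he : 0 < 2 * ε := by linarith
  have hcont := fun b => continuousOn_localAlt hf hc he b
  set ν := noiseLaw ρ σ with hν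
  by_cases hfin : ∑ i, alg.expVisits (localAlt f (2 * ε) (flipBit b i)) ρ σ
      (packInt f (2 * ε) i) = ∞
  · rw [hfin]; exact le_top
  have hfin' : ∀ i, alg.expVisits (localAlt f (2 * ε) (flipBit b i)) ρ σ
      (packInt f (2 * ε) i) ≠ ∞ := fun i => (ENNReal.sum_ne_top.1 hfin) i (Finset.mem_univ i)
  rw [ENNReal.ofReal_le_iff_le_toReal hfin, ENNReal.toReal_sum fun i _ => hfin' i]
  set R : (Fin (nPack f (2 * ε)) → Bool) → Set (U × (ℕ → ℝ)) := fun b' =>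
    alg.returnsNear (localAlt f (2 * ε) b) (localAlt f (2 * ε) b') (ENNReal.ofReal ε) with hR
  have hRm : ∀ b', MeasurableSet (R b') := fun b' =>
    alg.measurableSet_returnsNear (hcont b) (hcont b') ε.toNNReal
  have hRd : ∀ b' b'', b' ≠ b'' → Disjoint (R b') (R b'') := by
    intro b' b'' hne
    obtain ⟨z, hz, hzg⟩ := exists_localAlt_sub_eq hf hc he hne
    exact alg.disjoint_returnsNear hε hz hzg
  have hflip : ∀ i, flipBit b i ≠ b := by
    intro i h
    have := congrFun h i
    rw [flipBit_same] at this
    cases hb : b i <;> simp_all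
  have hflip2 : ∀ i j, i ≠ j → flipBit b i ≠ flipBit b j := by
    intro i j hij h
    have := congrFun h i
    rw [flipBit_same, flipBit, Function.update_of_ne hij] at this
    cases hb : b i <;> simp_all
  have hη : ∑ i, ν.real (R (flipBit b i)) ≤ δ := by
    rw [← measureReal_iUnion_fintype (fun i j hij => hRd _ _ (hflip2 i j hij)) fun i => hRm _]
    have hsub : (⋃ i, R (flipBit b i)) ⊆ (R b)ᶜ :=
      iUnion_subset fun i => (hRd _ _ (hflip i)).subset_compl_right
    have h2 := measureReal_mono (μ := ν) hsub
    rw [probReal_compl_eq_one_sub (hRm b)] at h2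
    have : 1 - δ ≤ ν.real (R b) := (hcor _ (mem_altClass b)).le_real
    linarith
  have hent : ∀ i, _ := fun i => alg.entropy_le_expVisits ρ σ hσ (hcont (flipBit b i)) (hcont b)
    (hcont (flipBit b i)) (D := packInt f (2 * ε) i) measurableSet_Ioo
    (fun x _ hx => localAlt_flipBit_eq hf hc he b i hx) (C := 4 * ε)
    (fun x _ => (abs_localAlt_flipBit_sub_le hf hc he b i x).trans (by linarith)) (hfin' i)
    ε.toNNReal (Real.log ((nPack f (2 * ε) : ℕ) * ((1 - δ) / δ))) (-Real.log ((1 - δ) / δ))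
  have h2 := (sum_entropy_bound hn h0 h1
    (fun i => (hcor _ (mem_altClass (flipBit b i))).le_real)
    (fun i => measureReal_nonneg) hη).trans (Finset.sum_le_sum fun i _ => hent i)
  rw [← Finset.mul_sum] at h2
  have hσ' : (0 : ℝ) < σ := by exact_mod_cast pos_iff_ne_zero.2 hσ
  have h4 := mul_le_mul_of_nonneg_left h2 (show 0 ≤ (σ : ℝ) ^ 2 / (8 * ε ^ 2) by positivity)
  have e1 : ∀ X : ℝ, (σ : ℝ) ^ 2 / (8 * ε ^ 2) * ((4 * ε) ^ 2 / (2 * (σ : ℝ) ^ 2) * X) = X := by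
    intro X; field_simp; ring
  have e2 : (σ : ℝ) ^ 2 / (8 * ε ^ 2) * ((nPack f (2 * ε) : ℕ) *
      (1 / 6 * Real.log ((nPack f (2 * ε) : ℕ) / δ))) =
      1 / 24 * ((nPack f (2 * ε) : ℕ) *
        ((σ : ℝ) ^ 2 / (2 * ε ^ 2) * Real.log ((nPack f (2 * ε) : ℕ) / δ))) := by
    field_simp; ring
  rwa [e1, e2] at h4

/-- The two lower bounds in terms of the packing number. -/
lemma packing_lower_bounds (hf : ConvexOn ℝ (Icc 0 1) f) (hc : ContinuousOn f (Icc 0 1))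
    (hε : 0 < ε) (h0 : 0 < δ) (h1 : δ < 1 / 3)
    (hcor : ∀ g ∈ altClass f (2 * ε), alg.Correct ρ σ ε δ g)
    (hcor0 : nPack f (2 * ε) = 0 → alg.Correct ρ σ ε δ (fun x => f x + 2 * ε)) :
    ENNReal.ofReal (1 / 24 * (((max 1 (nPack f (2 * ε)) : ℕ) : ℝ) *
        max 1 ((σ : ℝ) ^ 2 / (2 * ε ^ 2) * Real.log (1 / δ)))) ≤ alg.expTau ρ σ f ∧
    ENNReal.ofReal (1 / 24 * (((max 1 (nPack f (2 * ε)) : ℕ) : ℝ) *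
        max 1 ((σ : ℝ) ^ 2 / (2 * ε ^ 2) *
          Real.log (((max 1 (nPack f (2 * ε)) : ℕ) : ℝ) / δ))))
      ≤ (∑ g ∈ altClass f (2 * ε), alg.expTau ρ σ g) / ((altClass f (2 * ε)).card : ℝ≥0∞) := by
  have he : 0 < 2 * ε := by linarith
  have hall : ∀ b, ENNReal.ofReal (1 / 24 * (((max 1 (nPack f (2 * ε)) : ℕ) : ℝ) *
        max 1 ((σ : ℝ) ^ 2 / (2 * ε ^ 2) * Real.log (1 / δ))))
      ≤ alg.expTau ρ σ (localAlt f (2 * ε) b) := by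
    intro b
    rcases Nat.eq_zero_or_pos (nPack f (2 * ε)) with hz | hpos
    · have hb : localAlt f (2 * ε) b = f := by
        have : b = fun _ => false := funext fun i => absurd i.2 (by omega)
        rw [this, localAlt_false]
      rw [hb, hz, max_eq_left (Nat.zero_le 1), Nat.cast_one, one_mul]
      have hcf : alg.Correct ρ σ ε δ f := by
        have := hcor _ (mem_altClass b)
        rwa [hb] at this
      -- without packing intervals, `f` is compared with `f + 2 * ε`; they differ everywhere
      refine le_trans (ActiveAlgorithm.two_point_bound hc (hc.add continuousOn_const)
        MeasurableSet.univ (fun x _ hx => absurd (mem_univ x) hx) (fun x _ => ?_) hε h0 h1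
        (z := 0) ⟨le_rfl, zero_le_one⟩ ?_ hcf (hcor0 hz)) (alg.expVisits_le_expTau ρ σ hc _)
      · rw [Pi.add_apply, sub_add_cancel_left, abs_neg, abs_of_pos he]; linarith
      · simp [abs_of_pos hε]
    · rw [max_eq_right (show 1 ≤ nPack f (2 * ε) from hpos)]
      exact expTau_localAlt_ge hf hc hε h0 h1 hcor b
  refine ⟨by simpa [localAlt_false] using hall fun _ => false, ?_⟩
  have havg := le_average_altClass hf hc hε (Finset.sum_le_sum fun b _ => hall b)
  rcases lt_or_ge (nPack f (2 * ε)) 2 with hlt | hge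
  · have : max 1 (nPack f (2 * ε)) = 1 := max_eq_left (by omega)
    rw [this] at havg ⊢
    simpa using havg
  rcases le_total ((σ : ℝ) ^ 2 / (2 * ε ^ 2) *
      Real.log (((max 1 (nPack f (2 * ε)) : ℕ) : ℝ) / δ)) 1 with hm | hm
  · rw [max_eq_left hm]
    refine le_trans (ENNReal.ofReal_le_ofReal ?_) havg
    gcongr
    exact le_max_left _ _
  · have hσ : σ ≠ 0 := by
      rintro rfl
      norm_num at hm
    rw [max_eq_right hm, max_eq_right (show 1 ≤ nPack f (2 * ε) by omega)]
    exact le_average_altClass hf hc hε ((Finset.sum_le_sum fun b _ =>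
      sum_expVisits_flipBit_ge hf hc hε h0 h1 hσ hge hcor b).trans
        (sum_flipBit_expVisits_le hf hc hε))

end Main

end ConvexSampling

end

open ConvexSampling in
theorem theorem3 :
    ∃ c : ℝ, 0 < c ∧
      ∀ (f : ℝ → ℝ) (ε δ : ℝ) (σ : ℝ≥0) (U : Type*) [MeasurableSpace U] (ρ : Measure U)
        [IsProbabilityMeasure ρ] (alg : ActiveAlgorithm U),
        ConvexOn ℝ (Icc 0 1) f → ContinuousOn f (Icc 0 1) → 0 < ε → 0 < δ → δ < 1 / 3 →
        (∀ g ∈ altClass f (2 * ε), alg.Correct ρ σ ε δ g) →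
        -- the bounds in terms of `nLower`
        (ENNReal.ofReal (c * ((nLower f (2 * ε) : ℝ) *
            max 1 ((σ : ℝ) ^ 2 / (2 * ε ^ 2) * Real.log (1 / δ))))
          ≤ alg.expTau ρ σ f ∧
        ENNReal.ofReal (c * ((nLower f (2 * ε) : ℝ) *
            max 1 ((σ : ℝ) ^ 2 / (2 * ε ^ 2) * Real.log ((nLower f (2 * ε) : ℝ) / δ))))
          ≤ (∑ g ∈ altClass f (2 * ε), alg.expTau ρ σ g) / ((altClass f (2 * ε)).card : ℝ≥0∞)) ∧
        -- the bounds in terms of `max 1 nPack`; if the packing is empty, then the class is `{f}`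
        -- and the algorithm is also required to be correct on the alternative `f + 2 * ε`
        ((nPack f (2 * ε) = 0 → alg.Correct ρ σ ε δ (fun x => f x + 2 * ε)) →
          ENNReal.ofReal (c * (((max 1 (nPack f (2 * ε)) : ℕ) : ℝ) *
              max 1 ((σ : ℝ) ^ 2 / (2 * ε ^ 2) * Real.log (1 / δ))))
            ≤ alg.expTau ρ σ f ∧
          ENNReal.ofReal (c * (((max 1 (nPack f (2 * ε)) : ℕ) : ℝ) *
              max 1 ((σ : ℝ) ^ 2 / (2 * ε ^ 2) *
                Real.log (((max 1 (nPack f (2 * ε)) : ℕ) : ℝ) / δ))))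
            ≤ (∑ g ∈ altClass f (2 * ε), alg.expTau ρ σ g) /
              ((altClass f (2 * ε)).card : ℝ≥0∞)) := by
  refine ⟨1 / 24, by norm_num, ?_⟩
  intro f ε δ σ U _ ρ _ alg hf hc hε h0 h1 hcor
  refine ⟨?_, packing_lower_bounds hf hc hε h0 h1 hcor⟩
  have hle := nLower_le_nPack hf hc (show 0 < 2 * ε by linarith)
  rcases le_or_gt (nLower f (2 * ε)) 0 with hneg | hpos
  · have hneg' : (nLower f (2 * ε) : ℝ) ≤ 0 := by exact_mod_cast hneg
    -- the bounds are trivial here, since the left-hand sides are nonpositive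
    have hz : ∀ x : ℝ, ENNReal.ofReal (1 / 24 * ((nLower f (2 * ε) : ℝ) * max 1 x)) = 0 :=
      fun x => ENNReal.ofReal_of_nonpos (mul_nonpos_of_nonneg_of_nonpos (by norm_num)
        (mul_nonpos_of_nonpos_of_nonneg hneg' (zero_le_one.trans (le_max_left _ _))))
    rw [hz, hz]
    exact ⟨zero_le, zero_le⟩
  · obtain ⟨b1, b2⟩ := packing_lower_bounds hf hc hε h0 h1 hcor fun hz => by omega
    have hN0 : (0 : ℝ) < nLower f (2 * ε) := by exact_mod_cast hpos
    have hN : (nLower f (2 * ε) : ℝ) ≤ (max 1 (nPack f (2 * ε)) : ℕ) := by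
      have : nLower f (2 * ε) ≤ ((max 1 (nPack f (2 * ε)) : ℕ) : ℤ) := by
        push_cast; exact hle.trans (le_max_right _ _)
      exact_mod_cast this
    refine ⟨le_trans (ENNReal.ofReal_le_ofReal ?_) b1, le_trans (ENNReal.ofReal_le_ofReal ?_) b2⟩
    · gcongr
    · gcongr
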